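/- All algebras are vector spaces over $\mathbb C$ with a bilinear product $xy$, and $J(x,y,z)=(xy)z+(yz)x+(zx)y$. An anticommutative algebra is called Lie if $J(x,y,z)=0$ for all $x,y,z$, Malcev if $J(x,y,xz)=J(x,y,z)x$ for all $x,y,z$, and Tortkara if $(ab)(cb)=J(a,b,c)b$ for all $a,b,c$. An algebra is metabelian if $(xy)(zt)=0$ for all $x,y,z,t$, and nilpotent if for some $n\ge 1$ all products of $n$ elements, in every arrangement of brackets, vanish. Consider the following list of anticommutative algebras with basis $e_1,\dots,e_6$ (products $e_ie_j$, $i<j$, that are not written are zero). Lie algebras: $L_{2}$: $e_1e_2=e_3$; $L_{3}$: $e_1e_2=e_3,\ e_1e_3=e_4$; $L_{4}$: $e_1e_2=e_5,\ e_3e_4=e_5$; $L_{5}$: $e_1e_2=e_3,\ e_1e_3=e_5,\ e_2e_4=e_5$; $L_{6}$: $e_1e_2=e_3,\ e_1e_3=e_4,\ e_1e_4=e_5,\ e_2e_3=e_5$; $L_{7}$: $e_1e_2=e_3,\ e_1e_3=e_4,\ e_1e_4=e_5$; $L_{8}$: $e_1e_2=e_4,\ e_1e_3=e_5$; $L_{9}$: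 $e_1e_2=e_3,\ e_1e_3=e_4,\ e_2e_3=e_5$; $L_{10}$: $e_1e_2=e_3,\ e_1e_3=e_6,\ e_4e_5=e_6$; $L_{11}$: $e_1e_2=e_3,\ e_1e_3=e_4,\ e_1e_4=e_6,\ e_2e_3=e_6,\ e_2e_5=e_6$; $L_{12}$: $e_1e_2=e_3,\ e_1e_3=e_4,\ e_1e_4=e_6,\ e_2e_5=e_6$; $L_{13}$: $e_1e_2=e_3,\ e_1e_3=e_5,\ e_2e_4=e_5,\ e_1e_5=e_6,\ e_3e_4=e_6$; $L_{14}$: $e_1e_2=e_3,\ e_1e_3=e_4,\ e_1e_4=e_5,\ e_2e_3=e_5,\ e_2e_5=e_6,\ e_3e_4=-e_6$; $L_{15}$: $e_1e_2=e_3,\ e_1e_3=e_4,\ e_1e_4=e_5,\ e_2e_3=e_5,\ e_1e_5=e_6,\ e_2e_4=e_6$; $L_{16}$: $e_1e_2=e_3,\ e_1e_3=e_4,\ e_1e_4=e_5,\ e_2e_5=e_6,\ e_3e_4=-e_6$; $L_{17}$: $e_1e_2=e_3,\ e_1e_3=e_4,\ e_1e_4=e_5,\ e_1e_5=e_6,\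 e_2e_3=e_6$; $L_{18}$: $e_1e_2=e_3,\ e_1e_3=e_4,\ e_1e_4=e_5,\ e_1e_5=e_6$; $L_{19}^{\varepsilon}$, $\varepsilon\in\{0,1\}$: $e_1e_2=e_4,\ e_1e_3=e_5,\ e_2e_4=e_6,\ e_3e_5=\varepsilon e_6$; $L_{20}$: $e_1e_2=e_4,\ e_1e_3=e_5,\ e_1e_5=e_6,\ e_2e_4=e_6$; $L_{21}^{\varepsilon}$, $\varepsilon\in\{0,1\}$: $e_1e_2=e_3,\ e_1e_3=e_4,\ e_2e_3=e_5,\ e_1e_4=e_6,\ e_2e_5=\varepsilon e_6$; $L_{22}^{\varepsilon}$, $\varepsilon\in\{0,1\}$: $e_1e_2=e_5,\ e_1e_3=e_6,\ e_2e_4=\varepsilon e_6,\ e_3e_4=e_5$; $L_{23}$: $e_1e_2=e_3,\ e_1e_3=e_5,\ e_1e_4=e_6,\ e_2e_4=e_5$; $L_{24}^{\varepsilon}$, $\varepsilon\in\{0,1\}$: $e_1e_2=e_3,\ e_1e_3=e_5,\ e_1e_4=\varepsilon e_6,\ e_2e_3=e_6,\ e_2e_4=e_5$; $L_{25}$: $e_1e_2=e_3,\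 e_1e_3=e_5,\ e_1e_4=e_6$; $L_{26}$: $e_1e_2=e_4,\ e_1e_3=e_5,\ e_2e_3=e_6$. Non-Lie Malcev algebras: $M_{1}$: $e_1e_2=e_3,\ e_3e_4=e_5$; $M_{2}$: $e_1e_2=e_3,\ e_3e_4=e_5,\ e_1e_3=e_6$; $M_{3}$: $e_1e_2=e_3,\ e_3e_4=e_5,\ e_1e_4=e_6$; $M_{4}$: $e_1e_2=e_3,\ e_3e_4=e_5,\ e_1e_3=e_6,\ e_2e_4=e_6$; $M_{5}$: $e_1e_2=e_3,\ e_1e_5=e_6,\ e_3e_4=e_6$; $M_{6}$: $e_1e_2=e_3,\ e_1e_3=e_4,\ e_1e_4=e_6,\ e_3e_5=e_6$; $M_{7}^{\alpha}$, $\alpha\in\mathbb C\setminus\{-1\}$: $e_1e_2=e_4,\ e_1e_3=e_5,\ e_2e_4=e_6,\ e_2e_5=e_6,\ e_3e_4=-e_6,\ e_3e_5=\alpha e_6$; $M_{8}$: $e_1e_2=e_4,\ e_1e_3=e_5,\ e_2e_5=e_6,\ e_3e_4=-e_6$; $M_{9}$: $e_1e_2=e_4,\ e_1e_3=e_5,\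 e_1e_4=e_6,\ e_2e_5=e_6$; $M_{10}$: $e_1e_2=e_5,\ e_3e_4=e_5,\ e_1e_5=e_6$; $M_{11}$: $e_1e_2=e_5,\ e_3e_4=e_5,\ e_1e_5=e_6,\ e_2e_3=e_6$; $M_{12}^{\alpha}$, $\alpha\in\mathbb C\setminus\{-1\}$: $e_1e_2=e_3,\ e_1e_4=e_5,\ e_2e_3=e_5,\ e_2e_5=e_6,\ e_3e_4=\alpha e_6$; $M_{13}$: $e_1e_2=e_3,\ e_1e_4=e_5,\ e_2e_3=e_5,\ e_1e_3=e_6,\ e_2e_5=e_6$. Then: (1) Every algebra of the list is a nilpotent Malcev algebra with nonzero product. (2) Every $6$-dimensional nilpotent Malcev algebra over $\mathbb C$ that is not a Lie algebra is Tortkara, and every $6$-dimensional nilpotent Malcev algebra over $\mathbb C$ that is metabelian (in particular, every metabelian nilpotent Lie algebra of dimension $6$) is Tortkara. (3) Every $6$-dimensional nilpotent algebra over $\mathbb C$ with nonzero product that is both Malcev and Tortkara is isomorphic to an algebra of the list. -/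

import Mathlib

namespace NilpMalcev

/-- A (not necessarily associative) complex algebra structure on a vector space `V`:
a bilinear product. -/
abbrev Alg (V : Type*) [AddCommGroup V] [Module ℂ V] : Type _ := V →ₗ[ℂ] V →ₗ[ℂ] V

section Properties

variable {V : Type*} [AddCommGroup V] [Module ℂ V]

def IsAnticomm (μ : Alg V) : Prop := ∀ x y, μ x y = -μ y x

/-- `J(x,y,z) = (xy)z + (yz)x + (zx)y`. -/
def jac (μ : Alg V) (x y z : V) : V := μ (μ x y) z + μ (μ y z) x + μ (μ z x) y

def IsLie (μ : Alg V) : Prop := IsAnticomm μ ∧ ∀ x y z, jac μ x y z = 0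

/-- Malcev algebra: anticommutative and `J(x,y,xz) = J(x,y,z)x`. -/
def IsMalcev (μ : Alg V) : Prop :=
  IsAnticomm μ ∧ ∀ x y z, jac μ x y (μ x z) = μ (jac μ x y z) x

/-- Tortkara algebra: anticommutative and `(ab)(cb) = J(a,b,c)b`. -/
def IsTortkara (μ : Alg V) : Prop :=
  IsAnticomm μ ∧ ∀ a b c, μ (μ a b) (μ c b) = μ (jac μ a b c) b

/-- Metabelian: `(xy)(zt) = 0`. -/
def IsMetabelian (μ : Alg V) : Prop := ∀ x y z t, μ (μ x y) (μ z t) = 0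

/-- `IsProd μ n a`: `a` is a product of `n` elements with some arrangement of brackets. -/
inductive IsProd (μ : Alg V) : ℕ → V → Prop
  | single (a : V) : IsProd μ 1 a
  | mul {m n : ℕ} {a b : V} : IsProd μ m a → IsProd μ n b → IsProd μ (m + n) (μ a b)

/-- Nilpotent: for some `n ≥ 1` all products of `n` elements, however bracketed, vanish. -/
def IsNilp (μ : Alg V) : Prop := ∃ n, 1 ≤ n ∧ ∀ a, IsProd μ n a → a = 0

end Properties

/-- Isomorphism of algebras. -/
def Iso {V W : Type*} [AddCommGroup V] [Module ℂ V] [AddCommGroup W] [Module ℂ W]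
    (μ : Alg V) (ν : Alg W) : Prop :=
  ∃ f : V ≃ₗ[ℂ] W, ∀ x y, f (μ x y) = ν (f x) (f y)

/-- The product on `ℂ⁶`, with basis `e₁, …, e₆`, given by `eᵢ eⱼ = eₖ = -(eⱼ eᵢ)`, all other
products of basis vectors being zero (for `i ≠ j`). The basis is indexed by `Fin 6`, where the
numeral `6` is the same element as `0`; so `1, …, 6` name the six basis vectors. Sums of such
products give multiplication tables. -/
def prd (i j k : Fin 6) : Alg (Fin 6 → ℂ) :=
  LinearMap.mk₂ ℂ (fun x y => Pi.single k (x i * y j - x j * y i))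
    (fun x x' y => by rw [← Pi.single_add]; congr 1; simp only [Pi.add_apply]; ring)
    (fun c x y => by
      rw [← Pi.single_smul]; congr 1; simp only [Pi.smul_apply, smul_eq_mul]; ring)
    (fun x y y' => by rw [← Pi.single_add]; congr 1; simp only [Pi.add_apply]; ring)
    (fun c x y => by
      rw [← Pi.single_smul]; congr 1; simp only [Pi.smul_apply, smul_eq_mul]; ring)

/-- The list of the nilpotent Malcev algebras of dimension 6 over `ℂ` with nonzero product:
the Lie algebras (`L…`) and the non-Lie Malcev algebras (`M…`, among them two one-parameter
families). -/
inductive IsListed : Alg (Fin 6 → ℂ) → Prop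
  | L2 : IsListed (prd 1 2 3)
  | L3 : IsListed (prd 1 2 3 + prd 1 3 4)
  | L4 : IsListed (prd 1 2 5 + prd 3 4 5)
  | L5 : IsListed (prd 1 2 3 + prd 1 3 5 + prd 2 4 5)
  | L6 : IsListed (prd 1 2 3 + prd 1 3 4 + prd 1 4 5 + prd 2 3 5)
  | L7 : IsListed (prd 1 2 3 + prd 1 3 4 + prd 1 4 5)
  | L8 : IsListed (prd 1 2 4 + prd 1 3 5)
  | L9 : IsListed (prd 1 2 3 + prd 1 3 4 + prd 2 3 5)
  | L10 : IsListed (prd 1 2 3 + prd 1 3 6 + prd 4 5 6)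
  | L11 : IsListed (prd 1 2 3 + prd 1 3 4 + prd 1 4 6 + prd 2 3 6 + prd 2 5 6)
  | L12 : IsListed (prd 1 2 3 + prd 1 3 4 + prd 1 4 6 + prd 2 5 6)
  | L13 : IsListed (prd 1 2 3 + prd 1 3 5 + prd 2 4 5 + prd 1 5 6 + prd 3 4 6)
  | L14 : IsListed (prd 1 2 3 + prd 1 3 4 + prd 1 4 5 + prd 2 3 5 + prd 2 5 6 - prd 3 4 6)
  | L15 : IsListed (prd 1 2 3 + prd 1 3 4 + prd 1 4 5 + prd 2 3 5 + prd 1 5 6 + prd 2 4 6)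
  | L16 : IsListed (prd 1 2 3 + prd 1 3 4 + prd 1 4 5 + prd 2 5 6 - prd 3 4 6)
  | L17 : IsListed (prd 1 2 3 + prd 1 3 4 + prd 1 4 5 + prd 1 5 6 + prd 2 3 6)
  | L18 : IsListed (prd 1 2 3 + prd 1 3 4 + prd 1 4 5 + prd 1 5 6)
  | L19a : IsListed (prd 1 2 4 + prd 1 3 5 + prd 2 4 6)
  | L19b : IsListed (prd 1 2 4 + prd 1 3 5 + prd 2 4 6 + prd 3 5 6)
  | L20 : IsListed (prd 1 2 4 + prd 1 3 5 + prd 1 5 6 + prd 2 4 6)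
  | L21a : IsListed (prd 1 2 3 + prd 1 3 4 + prd 2 3 5 + prd 1 4 6)
  | L21b : IsListed (prd 1 2 3 + prd 1 3 4 + prd 2 3 5 + prd 1 4 6 + prd 2 5 6)
  | L22a : IsListed (prd 1 2 5 + prd 1 3 6 + prd 3 4 5)
  | L22b : IsListed (prd 1 2 5 + prd 1 3 6 + prd 2 4 6 + prd 3 4 5)
  | L23 : IsListed (prd 1 2 3 + prd 1 3 5 + prd 1 4 6 + prd 2 4 5)
  | L24a : IsListed (prd 1 2 3 + prd 1 3 5 + prd 2 3 6 + prd 2 4 5)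
  | L24b : IsListed (prd 1 2 3 + prd 1 3 5 + prd 1 4 6 + prd 2 3 6 + prd 2 4 5)
  | L25 : IsListed (prd 1 2 3 + prd 1 3 5 + prd 1 4 6)
  | L26 : IsListed (prd 1 2 4 + prd 1 3 5 + prd 2 3 6)
  | M1 : IsListed (prd 1 2 3 + prd 3 4 5)
  | M2 : IsListed (prd 1 2 3 + prd 3 4 5 + prd 1 3 6)
  | M3 : IsListed (prd 1 2 3 + prd 3 4 5 + prd 1 4 6)
  | M4 : IsListed (prd 1 2 3 + prd 3 4 5 + prd 1 3 6 + prd 2 4 6)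
  | M5 : IsListed (prd 1 2 3 + prd 1 5 6 + prd 3 4 6)
  | M6 : IsListed (prd 1 2 3 + prd 1 3 4 + prd 1 4 6 + prd 3 5 6)
  | M7 (α : ℂ) (hα : α ≠ -1) :
      IsListed (prd 1 2 4 + prd 1 3 5 + prd 2 4 6 + prd 2 5 6 - prd 3 4 6 + α • prd 3 5 6)
  | M8 : IsListed (prd 1 2 4 + prd 1 3 5 + prd 2 5 6 - prd 3 4 6)
  | M9 : IsListed (prd 1 2 4 + prd 1 3 5 + prd 1 4 6 + prd 2 5 6)
  | M10 : IsListed (prd 1 2 5 + prd 3 4 5 + prd 1 5 6)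
  | M11 : IsListed (prd 1 2 5 + prd 3 4 5 + prd 1 5 6 + prd 2 3 6)
  | M12 (α : ℂ) (hα : α ≠ -1) :
      IsListed (prd 1 2 3 + prd 1 4 5 + prd 2 3 5 + prd 2 5 6 + α • prd 3 4 6)
  | M13 : IsListed (prd 1 2 3 + prd 1 4 5 + prd 2 3 5 + prd 1 3 6 + prd 2 5 6)

end NilpMalcev

/-! The proof classifies all nilpotent Malcev algebras by one-dimensional central extensions,
climbing from dimension one to dimension six, and then reads the claims off the list.

A nonzero nilpotent algebra has a central vector `z ≠ 0` (`IsNilp.exists_central`). Dividing by `z`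
gives a nilpotent Malcev algebra `B` of dimension one less, and the algebra is `extend B θ` for a
skew form `θ` (`exists_extension`). If the annihilator is not inside the square, `z` can be taken
outside the square and `θ = 0`: the algebra is `B` plus a split line. Otherwise `B` runs through the
shorter list. The Malcev identity on a few vectors gives linear conditions on the coefficients of
`θ`, the condition `AnnLeSq` rules out the degenerate forms, and an explicit change of basis brings
every remaining form to a listed table (`classify_extensions`, `Iso.of_basis`). No orbit theory is
needed: only completeness of the list is proved, not that its members are pairwise non-isomorphic.

For the Tortkara claims, every listed algebra is either Tortkara or a non-metabelian Lie algebra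
(`IsListed.isTortkara_or`), and this dichotomy is invariant under isomorphism.

Coordinates: in `Fin n` the numeral `n` is `0`. So a vector `![…]` lists the coefficient of the last
basis vector first, and in the matrices passed to `Iso.of_basis` the first row is the new last basis
vector. -/

namespace NilpMalcev

/-! ### Invariance under surjective homomorphisms and isomorphisms. -/

section Transfer

variable {V W U : Type*} [AddCommGroup V] [Module ℂ V] [AddCommGroup W] [Module ℂ W]
  [AddCommGroup U] [Module ℂ U] {μ : Alg V} {ν : Alg W} {ξ : Alg U}

theorem Iso.symm (h : Iso μ ν) : Iso ν μ := by
  obtain ⟨f, hf⟩ := h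
  exact ⟨f.symm, fun x y => by rw [LinearEquiv.symm_apply_eq]; simp [hf]⟩

theorem Iso.trans (h : Iso μ ν) (h' : Iso ν ξ) : Iso μ ξ := by
  obtain ⟨f, hf⟩ := h
  obtain ⟨g, hg⟩ := h'
  exact ⟨f.trans g, fun x y => by simp [hf, hg]⟩

/-- `f` is a surjective homomorphism of algebras. -/
def IsSurjHom (μ : Alg V) (ν : Alg W) (f : V →ₗ[ℂ] W) : Prop :=
  Function.Surjective f ∧ ∀ x y, f (μ x y) = ν (f x) (f y)

theorem Iso.exists_surjHom (h : Iso μ ν) : ∃ f, IsSurjHom μ ν f := by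
  obtain ⟨f, hf⟩ := h
  exact ⟨f.toLinearMap, f.surjective, hf⟩

variable {f : V →ₗ[ℂ] W}

theorem IsSurjHom.map_jac (hf : IsSurjHom μ ν f) (x y z : V) :
    f (jac μ x y z) = jac ν (f x) (f y) (f z) := by
  simp [jac, hf.2]

theorem IsSurjHom.isAnticomm (hf : IsSurjHom μ ν f) (h : IsAnticomm μ) : IsAnticomm ν := by
  intro x y
  obtain ⟨x, rfl⟩ := hf.1 x
  obtain ⟨y, rfl⟩ := hf.1 y
  rw [← hf.2, h, map_neg, hf.2]

theorem IsSurjHom.isLie (hf : IsSurjHom μ ν f) (h : IsLie μ) : IsLie ν := by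
  refine ⟨hf.isAnticomm h.1, fun x y z => ?_⟩
  obtain ⟨x, rfl⟩ := hf.1 x
  obtain ⟨y, rfl⟩ := hf.1 y
  obtain ⟨z, rfl⟩ := hf.1 z
  rw [← hf.map_jac, h.2, map_zero]

theorem IsSurjHom.isMalcev (hf : IsSurjHom μ ν f) (h : IsMalcev μ) : IsMalcev ν := by
  refine ⟨hf.isAnticomm h.1, fun x y z => ?_⟩
  obtain ⟨x, rfl⟩ := hf.1 x
  obtain ⟨y, rfl⟩ := hf.1 y
  obtain ⟨z, rfl⟩ := hf.1 z
  rw [← hf.2, ← hf.map_jac, ← hf.map_jac, ← hf.2, h.2]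

theorem IsSurjHom.isTortkara (hf : IsSurjHom μ ν f) (h : IsTortkara μ) : IsTortkara ν := by
  refine ⟨hf.isAnticomm h.1, fun x y z => ?_⟩
  obtain ⟨x, rfl⟩ := hf.1 x
  obtain ⟨y, rfl⟩ := hf.1 y
  obtain ⟨z, rfl⟩ := hf.1 z
  rw [← hf.2, ← hf.2, ← hf.2, ← hf.map_jac, ← hf.2, h.2]

theorem IsSurjHom.isMetabelian (hf : IsSurjHom μ ν f) (h : IsMetabelian μ) :
    IsMetabelian ν := by
  intro x y z t
  obtain ⟨x, rfl⟩ := hf.1 x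
  obtain ⟨y, rfl⟩ := hf.1 y
  obtain ⟨z, rfl⟩ := hf.1 z
  obtain ⟨t, rfl⟩ := hf.1 t
  rw [← hf.2, ← hf.2, ← hf.2, h, map_zero]

theorem IsSurjHom.isNilp (hf : IsSurjHom μ ν f) (h : IsNilp μ) : IsNilp ν := by
  obtain ⟨n, hn, h⟩ := h
  have key : ∀ n b, IsProd ν n b → ∃ a, IsProd μ n a ∧ f a = b := by
    intro n b hb
    induction hb with
    | single b =>
      obtain ⟨a, rfl⟩ := hf.1 b
      exact ⟨a, .single a, rfl⟩
    | mul _ _ iha ihb =>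
      obtain ⟨a, ha, rfl⟩ := iha
      obtain ⟨b, hb, rfl⟩ := ihb
      exact ⟨μ a b, ha.mul hb, hf.2 a b⟩
  refine ⟨n, hn, fun b hb => ?_⟩
  obtain ⟨a, ha, rfl⟩ := key n b hb
  rw [h a ha, map_zero]

/-- The annihilator of the algebra is contained in its square. -/
def AnnLeSq (μ : Alg V) : Prop :=
  ∀ z, (∀ x, μ z x = 0) → ∀ φ : V →ₗ[ℂ] ℂ, (∀ x y, φ (μ x y) = 0) → φ z = 0

theorem Iso.annLeSq (h : Iso μ ν) (hμ : AnnLeSq μ) : AnnLeSq ν := by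
  obtain ⟨f, hf⟩ := h
  intro z hz φ hφ
  have := hμ (f.symm z) (fun x => f.injective (by rw [hf]; simp [hz])) (φ ∘ₗ f.toLinearMap)
    (fun x y => by simp [hf, hφ])
  simpa using this

theorem Iso.isMalcev (h : Iso μ ν) (hμ : IsMalcev μ) : IsMalcev ν := by
  obtain ⟨f, hf⟩ := h.exists_surjHom
  exact hf.isMalcev hμ

end Transfer

/-! ### Central vectors and the quotient by a central line. -/

section Reduction

variable {V : Type*} [AddCommGroup V] [Module ℂ V] {μ : Alg V}

/-- Just below the least length in which all products vanish there is a nonzero product; multiplying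
it by any vector reaches the vanishing length, so it is central. -/
theorem IsNilp.exists_central [Nontrivial V] (h : IsNilp μ) : ∃ z ≠ 0, ∀ x, μ z x = 0 := by
  classical
  have h' : ∃ n, ∀ a, IsProd μ (n + 1) a → a = 0 := by
    obtain ⟨n, hn, h⟩ := h
    exact ⟨n - 1, by rwa [Nat.sub_add_cancel hn]⟩
  have hs := Nat.find_spec h'
  rcases hm : Nat.find h' with _ | m
  · rw [hm] at hs
    obtain ⟨a, ha⟩ := exists_ne (0 : V)
    exact absurd (hs a (.single a)) ha
  · rw [hm] at hs
    have := Nat.find_min h' (m := m) (by omega)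
    push Not at this
    obtain ⟨a, ha, ha0⟩ := this
    exact ⟨a, ha0, fun x => hs _ (ha.mul (.single x))⟩

/-- Splitting off a central line: the quotient by `z` is modelled on the complement `ker φ`. -/
theorem exists_quotient (hA : IsAnticomm μ) {z : V} (hz : ∀ x, μ z x = 0) {φ : V →ₗ[ℂ] ℂ}
    (hφ : φ z = 1) : ∃ (B : Alg (LinearMap.ker φ)) (π : V →ₗ[ℂ] LinearMap.ker φ),
      IsSurjHom μ B π ∧ (∀ v, φ v = 0 → π v = 0 → v = 0) ∧
      ∀ x y, φ (μ x y) = φ (μ (π x) (π y)) := by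
  have hz' : ∀ x, μ x z = 0 := fun x => by rw [hA, hz, neg_zero]
  let π : V →ₗ[ℂ] LinearMap.ker φ :=
    (LinearMap.id - φ.smulRight z).codRestrict _ (fun v => by simp [hφ])
  have hπ : ∀ v, (π v : V) = v - φ v • z := fun v => rfl
  -- Correcting by multiples of the central `z` does not change products.
  have hμ : ∀ x y, μ (π x) (π y) = μ x y := fun x y => by simp [hπ, hz, hz']
  have hπ' : ∀ v : LinearMap.ker φ, π v = v := fun v => Subtype.ext (by simp [hπ])
  refine ⟨(μ.compl₁₂ (LinearMap.ker φ).subtype (LinearMap.ker φ).subtype).compr₂ π, π,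
    ⟨fun v => ⟨v, hπ' v⟩, fun x y => ?_⟩, fun v h0 h1 => ?_, fun x y => by rw [hμ]⟩
  · simp [hμ]
  · have := congrArg Subtype.val h1
    simpa [hπ, h0] using this

end Reduction

/-! ### One-dimensional central extensions in coordinates. -/

section Extension

/-- The inclusion of the index set of an `n`-dimensional algebra into that of its one-dimensional
extension; the numerals `1, …, n` are preserved, where `n` is the same element as `0` of `Fin n`. -/
def up {n : ℕ} [NeZero n] (i : Fin n) : Fin (n + 1) := if i = 0 then Fin.last n else i.castSucc

/-- The left inverse of `up`, away from the new index `0`. -/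
def down {n : ℕ} [NeZero n] (j : Fin (n + 1)) : Fin n := Fin.ofNat n j

theorem down_up {n : ℕ} [NeZero n] (i : Fin n) : down (up i) = i := by
  unfold down up
  split_ifs with h
  · subst h; ext; simp
  · ext; simp

theorem up_ne_zero {n : ℕ} [NeZero n] (i : Fin n) : up i ≠ 0 := by
  unfold up
  split_ifs with h
  · exact fun h => NeZero.ne n (congrArg Fin.val h)
  · intro h'
    have := congrArg Fin.val h'
    rw [Fin.val_castSucc, Fin.val_zero] at this
    exact h (Fin.ext (by rw [this, Fin.val_zero]))

theorem up_down {n : ℕ} [NeZero n] {j : Fin (n + 1)} (h : j ≠ 0) : up (down j) = j := by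
  unfold up down
  have hj := j.isLt
  rcases (Nat.lt_succ_iff.1 hj).lt_or_eq with h' | h'
  · rw [if_neg]
    · ext; simp [Nat.mod_eq_of_lt h']
    · exact fun h0 => h (Fin.ext (by
        have := congrArg Fin.val h0
        rw [Fin.val_ofNat, Nat.mod_eq_of_lt h', Fin.val_zero] at this
        rw [this, Fin.val_zero]))
  · rw [if_pos]
    · ext; simp [h']
    · ext; simp [h']

variable {n : ℕ}

/-- The product `eᵢ eⱼ = eₖ = -(eⱼ eᵢ)` on `ℂⁿ`. -/
def pr (i j k : Fin n) : Alg (Fin n → ℂ) :=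
  LinearMap.mk₂ ℂ (fun x y => Pi.single k (x i * y j - x j * y i))
    (fun x x' y => by rw [← Pi.single_add]; congr 1; simp only [Pi.add_apply]; ring)
    (fun c x y => by
      rw [← Pi.single_smul]; congr 1; simp only [Pi.smul_apply, smul_eq_mul]; ring)
    (fun x y y' => by rw [← Pi.single_add]; congr 1; simp only [Pi.add_apply]; ring)
    (fun c x y => by
      rw [← Pi.single_smul]; congr 1; simp only [Pi.smul_apply, smul_eq_mul]; ring)

theorem pr_apply (i j k l : Fin n) (x y : Fin n → ℂ) :
    pr i j k x y l = if l = k then x i * y j - x j * y i else 0 := by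
  simp [pr, Pi.single_apply]

theorem prd_apply (i j k l : Fin 6) (x y : Fin 6 → ℂ) :
    prd i j k x y l = if l = k then x i * y j - x j * y i else 0 := pr_apply i j k l x y

/-- A skew-symmetric form in coordinates. -/
theorem exists_skew_matrix {θ : (Fin n → ℂ) →ₗ[ℂ] (Fin n → ℂ) →ₗ[ℂ] ℂ}
    (h : ∀ x y, θ x y = -θ y x) : ∃ t : Fin n → Fin n → ℂ, (∀ i j, t i j = -t j i) ∧
      ∀ x y, θ x y = ∑ i, ∑ j, t i j * (x i * y j) := by
  refine ⟨fun i j => θ (Pi.single i 1) (Pi.single j 1), fun i j => h _ _, fun x y => ?_⟩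
  conv_lhs => rw [pi_eq_sum_univ' x, pi_eq_sum_univ' y]
  simp only [map_sum, map_smul, LinearMap.sum_apply, LinearMap.smul_apply, smul_eq_mul,
    Finset.mul_sum]
  rw [Finset.sum_comm]
  exact Finset.sum_congr rfl fun i _ => Finset.sum_congr rfl fun j _ => by ring

variable [NeZero n]

/-- The one-dimensional central extension of `B` by the bilinear form `θ`. -/
def extend (B : Alg (Fin n → ℂ)) (θ : (Fin n → ℂ) →ₗ[ℂ] (Fin n → ℂ) →ₗ[ℂ] ℂ) :
    Alg (Fin (n + 1) → ℂ) :=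
  LinearMap.mk₂ ℂ
    (fun x y j => if j = 0 then θ (x ∘ up) (y ∘ up) else B (x ∘ up) (y ∘ up) (down j))
    (fun x x' y => by
      ext j; simp only [Pi.add_comp, map_add, LinearMap.add_apply, Pi.add_apply]; split_ifs <;> rfl)
    (fun c x y => by
      ext j; simp only [Pi.smul_comp, map_smul, LinearMap.smul_apply, Pi.smul_apply]
      split_ifs <;> rfl)
    (fun x y y' => by
      ext j; simp only [Pi.add_comp, map_add, Pi.add_apply]; split_ifs <;> rfl)
    (fun c x y => by
      ext j; simp only [Pi.smul_comp, map_smul, Pi.smul_apply]; split_ifs <;> rfl)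

theorem extend_apply (B : Alg (Fin n → ℂ)) (θ : (Fin n → ℂ) →ₗ[ℂ] (Fin n → ℂ) →ₗ[ℂ] ℂ)
    (x y : Fin (n + 1) → ℂ) (j : Fin (n + 1)) : extend B θ x y j =
      if j = 0 then θ (x ∘ up) (y ∘ up) else B (x ∘ up) (y ∘ up) (down j) := rfl

theorem extend_zero : extend (0 : Alg (Fin n → ℂ)) 0 = 0 := by
  ext; simp [extend_apply]

theorem extend_add (B B' : Alg (Fin n → ℂ)) : extend (B + B') 0 = extend B 0 + extend B' 0 := by
  refine LinearMap.ext₂ fun x y => funext fun j => ?_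
  simp only [extend_apply, LinearMap.add_apply, Pi.add_apply]
  split_ifs <;> simp

/-- Since `up` keeps the numerals, a multiplication table carries over verbatim when a split line is
added. -/
theorem extend_pr (i j k : Fin n) : extend (pr i j k) 0 = pr (up i) (up j) (up k) := by
  refine LinearMap.ext₂ fun x y => funext fun l => ?_
  simp only [extend_apply, pr_apply, Function.comp_apply]
  rcases eq_or_ne l 0 with rfl | hl
  · simp [(up_ne_zero k).symm]
  · have : down l = k ↔ l = up k :=
      ⟨fun h => by rw [← h, up_down hl], fun h => by rw [h, down_up]⟩
    simp [hl, this]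

/-- Every nilpotent Malcev algebra with a central element `z` is the central extension of an
algebra from any list that is complete in dimension one less. -/
theorem exists_extension {V : Type*} [AddCommGroup V] [Module ℂ V] {μ : Alg V}
    (hV : Module.finrank ℂ V = n + 1) (hN : IsNilp μ) (hM : IsMalcev μ)
    {C : Alg (Fin n → ℂ) → Prop}
    (hC : ∀ (W : Submodule ℂ V) (B : Alg W), Module.finrank ℂ W = n → IsNilp B → IsMalcev B →
      ∃ B', C B' ∧ Iso B B')
    {z : V} (hz : ∀ x, μ z x = 0) {φ : V →ₗ[ℂ] ℂ} (hφ : φ z = 1) :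
    ∃ B, C B ∧ ∃ θ : (Fin n → ℂ) →ₗ[ℂ] (Fin n → ℂ) →ₗ[ℂ] ℂ, (∀ x y, θ x y = -θ y x) ∧
      ((∀ x y, φ (μ x y) = 0) → θ = 0) ∧ Iso μ (extend B θ) := by
  have : FiniteDimensional ℂ V := Module.finite_of_finrank_eq_succ hV
  obtain ⟨B, π, hπ, hinj, hφμ⟩ := exists_quotient hM.1 hz hφ
  have hrk : Module.finrank ℂ (LinearMap.ker φ) = n := by
    have h1 := φ.finrank_range_add_finrank_ker
    have h2 : LinearMap.range φ = ⊤ := LinearMap.range_eq_top.2 fun c => ⟨c • z, by simp [hφ]⟩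
    rw [h2, finrank_top, Module.finrank_self] at h1
    omega
  obtain ⟨B', hB', f, hf⟩ := hC _ B hrk (hπ.isNilp hN) (hπ.isMalcev hM)
  -- `s` lifts the quotient to `ker φ`. The form is the `z`-component of the product of lifts, so it
  -- vanishes as soon as `φ` kills the square.
  let s : (Fin n → ℂ) →ₗ[ℂ] V := (LinearMap.ker φ).subtype ∘ₗ f.symm.toLinearMap
  refine ⟨B', hB', (μ.compl₁₂ s s).compr₂ φ, fun x y => ?_, fun h => ?_, ?_⟩
  · simp only [LinearMap.compr₂_apply, LinearMap.compl₁₂_apply]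
    rw [hM.1, map_neg]
  · ext; simp [h]
  · let g : V →ₗ[ℂ] (Fin (n + 1) → ℂ) :=
      { toFun := fun v j => if j = 0 then φ v else f (π v) (down j)
        map_add' := fun v w => by
          ext j; simp only [map_add, Pi.add_apply]; split_ifs <;> rfl
        map_smul' := fun c v => by
          ext j; simp only [map_smul, Pi.smul_apply, RingHom.id_apply]; split_ifs <;> rfl }
    have hg : ∀ v j, g v j = if j = 0 then φ v else f (π v) (down j) := fun _ _ => rfl
    have hgi : Function.Injective g := by
      rw [← LinearMap.ker_eq_bot, LinearMap.ker_eq_bot']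
      intro v hv
      refine hinj v ?_ (f.map_eq_zero_iff.1 (funext fun i => ?_))
      · simpa [hg] using congrFun hv 0
      · simpa [hg, up_ne_zero, down_up] using congrFun hv (up i)
    have hgu : ∀ v, g v ∘ up = f (π v) := fun v => funext fun i => by
      simp [hg, up_ne_zero, down_up]
    refine ⟨LinearEquiv.ofInjectiveOfFinrankEq g hgi (by simp [hV]), fun x y => ?_⟩
    ext j
    change g (μ x y) j = extend B' _ (g x) (g y) j
    simp only [extend_apply, hgu]
    simp only [hg, hπ.2, hf]
    congr 1
    simp [s, hφμ x y]

end Extension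
end NilpMalcev

namespace NilpMalcev

/-! ### Basis changes, the extension step, and use of the annihilator condition. -/

section Tools

variable {n : ℕ}

theorem Iso.refl {V : Type*} [AddCommGroup V] [Module ℂ V] (μ : Alg V) : Iso μ μ :=
  ⟨LinearEquiv.refl ℂ V, fun _ _ => rfl⟩

/-- If `v` is a basis in which `μ` has the multiplication table `ν`, then `μ` is isomorphic
to `ν`. -/
theorem Iso.of_basis {μ ν : Alg (Fin n → ℂ)} (v : Fin n → Fin n → ℂ)
    (h0 : ∀ x : Fin n → ℂ, (∀ i, ∑ j, x j * v j i = 0) → ∀ i, x i = 0 := by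
      intro x hx
      simp [Fin.forall_fin_succ, Fin.sum_univ_succ] at hx ⊢ <;> grind)
    (h : ∀ x y i, ∑ j, ν x y j * v j i =
      μ (fun i => ∑ j, x j * v j i) (fun i => ∑ j, y j * v j i) i := by
      intro x y
      simp [Fin.forall_fin_succ, Fin.sum_univ_succ, pr_apply, prd_apply]
      try constructorm* _ ∧ _
      all_goals first | ring1 | (field_simp; ring1) | grind) : Iso μ ν := by
  have hv : ∀ x i, Fintype.linearCombination ℂ v x i = ∑ j, x j * v j i := fun x i => by
    simp [Fintype.linearCombination_apply]
  -- The map sending the standard basis to the rows of `v` goes from `ν` to `μ`; by equal dimensions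
  -- injectivity suffices.
  refine Iso.symm ⟨LinearEquiv.ofInjectiveEndo (Fintype.linearCombination ℂ v) ?_,
    fun x y => funext fun i => ?_⟩
  · rw [← LinearMap.ker_eq_bot, LinearMap.ker_eq_bot']
    exact fun x hx => funext (h0 x fun i => by rw [← hv, hx]; rfl)
  · have := h x y i
    simp only [← hv] at this
    exact this

/-- Reduction of the classification to central extensions with annihilator inside the square. -/
theorem classify_extensions [NeZero n] {V : Type*} [AddCommGroup V] [Module ℂ V] {μ : Alg V}
    (hV : Module.finrank ℂ V = n + 1) (hN : IsNilp μ) (hM : IsMalcev μ)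
    {C : Alg (Fin n → ℂ) → Prop} {D : Alg (Fin (n + 1) → ℂ) → Prop}
    (hC : ∀ (W : Submodule ℂ V) (B : Alg W), Module.finrank ℂ W = n → IsNilp B → IsMalcev B →
      ∃ B', C B' ∧ Iso B B')
    (h0 : ∀ B, C B → D (extend B 0))
    (h1 : ∀ B, C B → ∀ θ : (Fin n → ℂ) →ₗ[ℂ] (Fin n → ℂ) →ₗ[ℂ] ℂ, (∀ x y, θ x y = -θ y x) →
      IsMalcev (extend B θ) → AnnLeSq (extend B θ) → ∃ ν, D ν ∧ Iso (extend B θ) ν) :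
    ∃ ν, D ν ∧ Iso μ ν := by
  by_cases hZ : AnnLeSq μ
  · have : Nontrivial V := Module.nontrivial_of_finrank_eq_succ hV
    obtain ⟨z, hz0, hz⟩ := hN.exists_central
    obtain ⟨φ, hφ⟩ := Module.Projective.exists_dual_eq_one ℂ hz0
    obtain ⟨B, hB, θ, hθ, -, h⟩ := exists_extension hV hN hM hC hz hφ
    obtain ⟨ν, hν, h'⟩ := h1 B hB θ hθ (h.isMalcev hM) (h.annLeSq hZ)
    exact ⟨ν, hν, h.trans h'⟩
  -- Here some central `z` lies outside the square; with a functional vanishing on the square and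
  -- normalised at `z`, the extension splits.
  · unfold AnnLeSq at hZ
    push Not at hZ
    obtain ⟨z, hz, φ, hφ, hφz⟩ := hZ
    obtain ⟨B, hB, θ, -, hθ, h⟩ := exists_extension hV hN hM hC hz (φ := (φ z)⁻¹ • φ)
      (by simp [hφz])
    rw [hθ fun x y => by simp [hφ]] at h
    exact ⟨_, h0 B hB, h⟩

/-- A central vector has vanishing `i`-th coordinate if all products do. -/
theorem AnnLeSq.coord_eq_zero {μ : Alg (Fin n → ℂ)} (h : AnnLeSq μ) (z : Fin n → ℂ) (i : Fin n)
    (hz : ∀ x j, μ z x j = 0 := by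
      intro x
      simp [Fin.forall_fin_succ, pr_apply, prd_apply] <;> grind)
    (hi : ∀ x y, μ x y i = 0 := by
      intro x y
      simp [pr_apply, prd_apply]) : z i = 0 :=
  h z (fun x => funext (hz x)) (LinearMap.proj i) hi

/-- The same, with a linear functional in place of a coordinate. -/
theorem AnnLeSq.dotProduct_eq_zero {μ : Alg (Fin n → ℂ)} (h : AnnLeSq μ) (z c : Fin n → ℂ)
    (hz : ∀ x j, μ z x j = 0 := by
      intro x
      simp [Fin.forall_fin_succ, pr_apply, prd_apply] <;> grind)
    (hi : ∀ x y, ∑ i, c i * μ x y i = 0 := by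
      intro x y
      simp [Fin.sum_univ_succ, pr_apply, prd_apply] <;> grind) : ∑ i, c i * z i = 0 := by
  have := h z (fun x => funext (hz x)) (∑ i, c i • LinearMap.proj i) (by simpa using hi)
  simpa using this

/-- A copy of a Malcev algebra that is known only through its coordinates. -/
theorem IsMalcev.exists_copy {μ : Alg (Fin n → ℂ)} (h : IsMalcev μ) :
    ∃ ν : Alg (Fin n → ℂ), IsMalcev ν ∧ ∀ x y i, ν x y i = μ x y i :=
  ⟨μ, h, fun _ _ _ => rfl⟩

end Tools
end NilpMalcev

namespace NilpMalcev

/-! ### Classification up to dimension five. -/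

section LowDimension

theorem extend_eq_two {B : Alg (Fin 1 → ℂ)} {θ : (Fin 1 → ℂ) →ₗ[ℂ] (Fin 1 → ℂ) →ₗ[ℂ] ℂ}
    (hθ : ∀ x y, θ x y = -θ y x) : extend B θ = extend B 0 := by
  obtain ⟨t, ht, h⟩ := exists_skew_matrix hθ
  have h0 : t 0 0 = 0 := by have := ht 0 0; grind
  have : θ = 0 := LinearMap.ext₂ fun x y => by simp [h, h0]
  rw [this]

theorem extend_eq_three {B : Alg (Fin 2 → ℂ)} {θ : (Fin 2 → ℂ) →ₗ[ℂ] (Fin 2 → ℂ) →ₗ[ℂ] ℂ}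
    (hθ : ∀ x y, θ x y = -θ y x) : ∃ a : ℂ, extend B θ = extend B 0 + a • pr 1 2 3 := by
  obtain ⟨t, ht, h⟩ := exists_skew_matrix hθ
  refine ⟨t 1 0, LinearMap.ext₂ fun x y => funext fun j => ?_⟩
  have h0 := ht 0 0
  have h1 := ht 1 1
  have h2 := ht 1 0
  revert j
  simp [Fin.forall_fin_succ, extend_apply, pr_apply, h, up]
  grind

theorem extend_eq_four {B : Alg (Fin 3 → ℂ)} {θ : (Fin 3 → ℂ) →ₗ[ℂ] (Fin 3 → ℂ) →ₗ[ℂ] ℂ}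
    (hθ : ∀ x y, θ x y = -θ y x) : ∃ a12 a13 a23 : ℂ, extend B θ =
      extend B 0 + (a12 • pr 1 2 4 + a13 • pr 1 3 4 + a23 • pr 2 3 4) := by
  obtain ⟨t, ht, h⟩ := exists_skew_matrix hθ
  refine ⟨t 1 2, t 1 0, t 2 0, LinearMap.ext₂ fun x y => funext fun j => ?_⟩
  simp only [Fin.forall_fin_succ] at ht
  revert j
  simp [Fin.forall_fin_succ, Fin.sum_univ_succ, extend_apply, pr_apply, h, up] at ht ⊢
  grind

/-- The products of a five-dimensional algebra with values in the line of `e₅`. -/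
def cen5 (a12 a13 a14 a23 a24 a34 : ℂ) : Alg (Fin 5 → ℂ) :=
  a12 • pr 1 2 5 + a13 • pr 1 3 5 + a14 • pr 1 4 5 + a23 • pr 2 3 5 + a24 • pr 2 4 5 +
    a34 • pr 3 4 5

@[simp]
theorem cen5_apply (a12 a13 a14 a23 a24 a34 : ℂ) (x y : Fin 5 → ℂ) (l : Fin 5) :
    cen5 a12 a13 a14 a23 a24 a34 x y l = if l = 0 then
      a12 * (x 1 * y 2 - x 2 * y 1) + a13 * (x 1 * y 3 - x 3 * y 1) +
      a14 * (x 1 * y 4 - x 4 * y 1) + a23 * (x 2 * y 3 - x 3 * y 2) +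
      a24 * (x 2 * y 4 - x 4 * y 2) + a34 * (x 3 * y 4 - x 4 * y 3) else 0 := by
  have : (5 : Fin 5) = 0 := rfl
  simp only [cen5, LinearMap.add_apply, LinearMap.smul_apply, Pi.add_apply, Pi.smul_apply,
    pr_apply, smul_eq_mul, this]
  split_ifs <;> ring

theorem extend_eq_five {B : Alg (Fin 4 → ℂ)} {θ : (Fin 4 → ℂ) →ₗ[ℂ] (Fin 4 → ℂ) →ₗ[ℂ] ℂ}
    (hθ : ∀ x y, θ x y = -θ y x) : ∃ a12 a13 a14 a23 a24 a34 : ℂ, extend B θ =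
      extend B 0 + cen5 a12 a13 a14 a23 a24 a34 := by
  obtain ⟨t, ht, h⟩ := exists_skew_matrix hθ
  refine ⟨t 1 2, t 1 3, t 1 0, t 2 3, t 2 0, t 3 0, LinearMap.ext₂ fun x y => funext fun j => ?_⟩
  simp only [Fin.forall_fin_succ] at ht
  revert j
  simp [Fin.forall_fin_succ, Fin.sum_univ_succ, extend_apply, h, up] at ht ⊢
  grind

inductive Listed3 : Alg (Fin 3 → ℂ) → Prop
  | zero : Listed3 0
  | L2 : Listed3 (pr 1 2 3)

inductive Listed4 : Alg (Fin 4 → ℂ) → Prop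
  | zero : Listed4 0
  | L2 : Listed4 (pr 1 2 3)
  | L3 : Listed4 (pr 1 2 3 + pr 1 3 4)

/-- Apart from zero, the names match `IsListed`: each entry plus a split line is the listed algebra
of that name. -/
inductive Listed5 : Alg (Fin 5 → ℂ) → Prop
  | zero : Listed5 0
  | L2 : Listed5 (pr 1 2 3)
  | L3 : Listed5 (pr 1 2 3 + pr 1 3 4)
  | L4 : Listed5 (pr 1 2 5 + pr 3 4 5)
  | L5 : Listed5 (pr 1 2 3 + pr 1 3 5 + pr 2 4 5)
  | L6 : Listed5 (pr 1 2 3 + pr 1 3 4 + pr 1 4 5 + pr 2 3 5)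
  | L7 : Listed5 (pr 1 2 3 + pr 1 3 4 + pr 1 4 5)
  | L8 : Listed5 (pr 1 2 4 + pr 1 3 5)
  | L9 : Listed5 (pr 1 2 3 + pr 1 3 4 + pr 2 3 5)
  | M1 : Listed5 (pr 1 2 3 + pr 3 4 5)

theorem classify_one {V : Type*} [AddCommGroup V] [Module ℂ V] {μ : Alg V}
    (hV : Module.finrank ℂ V = 1) (hA : IsAnticomm μ) : Iso μ (0 : Alg (Fin 1 → ℂ)) := by
  have : FiniteDimensional ℂ V := Module.finite_of_finrank_eq_succ hV
  refine ⟨LinearEquiv.ofFinrankEq _ _ (by simp [hV]), fun x y => ?_⟩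
  obtain ⟨v, -, hv⟩ := finrank_eq_one_iff'.1 hV
  obtain ⟨a, rfl⟩ := hv x
  obtain ⟨b, rfl⟩ := hv y
  have : IsAddTorsionFree V := .of_isTorsionFree ℂ V
  have : μ v v = 0 := self_eq_neg.1 (hA v v)
  simp [this]

theorem classify_two {V : Type*} [AddCommGroup V] [Module ℂ V] {μ : Alg V}
    (hV : Module.finrank ℂ V = 2) (hN : IsNilp μ) (hM : IsMalcev μ) :
    ∃ ν : Alg (Fin 2 → ℂ), ν = 0 ∧ Iso μ ν := by
  refine classify_extensions (C := (· = 0)) hV hN hM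
    (fun W B hW _ hB => ⟨0, rfl, classify_one hW hB.1⟩) ?_ ?_
  · rintro _ rfl
    exact extend_zero
  · rintro _ rfl θ hθ - -
    rw [extend_eq_two hθ, extend_zero]
    exact ⟨0, rfl, .refl 0⟩

theorem classify_three {V : Type*} [AddCommGroup V] [Module ℂ V] {μ : Alg V}
    (hV : Module.finrank ℂ V = 3) (hN : IsNilp μ) (hM : IsMalcev μ) :
    ∃ ν, Listed3 ν ∧ Iso μ ν := by
  refine classify_extensions hV hN hM (fun W B hW => classify_two hW) ?_ ?_
  · rintro _ rfl
    rw [extend_zero]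
    exact .zero
  · rintro _ rfl θ hθ - -
    obtain ⟨a, h⟩ := extend_eq_three (B := 0) hθ
    rw [h, extend_zero, zero_add]
    rcases eq_or_ne a 0 with rfl | ha
    · exact ⟨0, .zero, by rw [zero_smul]; exact .refl 0⟩
    · exact ⟨_, .L2, .of_basis ![![a, 0, 0], ![0, 1, 0], ![0, 0, 1]]⟩

theorem classify_four {V : Type*} [AddCommGroup V] [Module ℂ V] {μ : Alg V}
    (hV : Module.finrank ℂ V = 4) (hN : IsNilp μ) (hM : IsMalcev μ) :
    ∃ ν, Listed4 ν ∧ Iso μ ν := by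
  refine classify_extensions hV hN hM (fun W B hW => classify_three hW) ?_ ?_
  · rintro _ (_ | _)
    · rw [extend_zero]
      exact .zero
    · rw [extend_pr]
      exact .L2
  · intro B hB θ hθ
    obtain ⟨a12, a13, a23, h⟩ := extend_eq_four (B := B) hθ
    rw [h]
    intro _ hZ
    cases hB with
    | zero =>
      rw [extend_zero, zero_add] at hZ ⊢
      -- A skew form in three variables has `(a23, -a13, a12)` in its radical. The square lies in
      -- the line of `e₄`, so this central vector must be zero.
      have h1 := hZ.coord_eq_zero ![0, a23, -a13, a12] 1
      have h2 := hZ.coord_eq_zero ![0, a23, -a13, a12] 2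
      have h3 := hZ.coord_eq_zero ![0, a23, -a13, a12] 3
      simp at h1 h2 h3
      subst h1 h2 h3
      simpa using hZ.coord_eq_zero ![0, 1, 0, 0] 1
    | L2 =>
      have e : extend (pr (1 : Fin 3) 2 3) 0 = pr 1 2 3 := extend_pr _ _ _
      rw [e] at hZ ⊢
      refine ⟨_, .L3, ?_⟩
      rcases ne_or_eq a13 0 with h1 | rfl
      · exact .of_basis ![![a13, 0, 0, 0], ![0, 1, 0, 0], ![0, -a23 / a13, 1, 0], ![a12, 0, 0, 1]]
      rcases ne_or_eq a23 0 with h1 | rfl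
      · exact .of_basis ![![-a23, 0, 0, 0], ![0, 0, 1, 0], ![0, 1, 0, 0], ![-a12, 0, 0, -1]]
      -- The square is now the line of `e₃ + a12 e₄`; the functional separates the central `e₄` from
      -- it.
      simpa [Fin.sum_univ_succ] using hZ.dotProduct_eq_zero ![1, 0, 0, 0] ![1, 0, 0, -a12]

/-- Five-dimensional algebras with one-dimensional square equal to the annihilator. -/
theorem classify_five_abelian {a12 a13 a14 a23 a24 a34 : ℂ}
    (hZ : AnnLeSq (cen5 a12 a13 a14 a23 a24 a34)) :
    Iso (cen5 a12 a13 a14 a23 a24 a34) (pr (1 : Fin 5) 2 5 + pr 3 4 5) := by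
  have key : ∀ a12 a13 a14 a23 a24 a34 : ℂ, a12 ≠ 0 →
      AnnLeSq (cen5 a12 a13 a14 a23 a24 a34) →
      Iso (cen5 a12 a13 a14 a23 a24 a34) (pr (1 : Fin 5) 2 5 + pr 3 4 5) := by
    intro a12 a13 a14 a23 a24 a34 h hZ
    -- `d` is the Pfaffian. If nonzero, the form has a symplectic basis; if zero, `a23 e₁ - a13 e₂ +
    -- a12 e₃` is in the radical.
    obtain ⟨d, hd⟩ : ∃ d, d = a12 * a34 - a13 * a24 + a14 * a23 := ⟨_, rfl⟩
    rcases ne_or_eq d 0 with hd0 | rfl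
    · exact .of_basis ![![a12 * d, 0, 0, 0, 0], ![0, 1, 0, 0, 0], ![0, 0, d, 0, 0],
        ![0, a23, -a13, a12, 0], ![0, a24, -a14, 0, a12]]
    · have := hZ.coord_eq_zero ![0, a23, -a13, a12, 0] 3
      simp at this
      exact absurd this h
  have step : ∀ {b12 b13 b14 b23 b24 b34 : ℂ},
      Iso (cen5 a12 a13 a14 a23 a24 a34)
      (cen5 b12 b13 b14 b23 b24 b34) → b12 ≠ 0 →
      Iso (cen5 a12 a13 a14 a23 a24 a34) (pr (1 : Fin 5) 2 5 + pr 3 4 5) :=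
    fun h hb => h.trans (key _ _ _ _ _ _ hb (h.annLeSq hZ))
  rcases ne_or_eq a12 0 with h | rfl
  · exact key _ _ _ _ _ _ h hZ
  rcases ne_or_eq a34 0 with h | rfl
  · exact step (b12 := a34) (b13 := -a13) (b14 := -a23) (b23 := -a14) (b24 := -a24) (b34 := 0)
      (.of_basis ![![1, 0, 0, 0, 0], ![0, 0, 0, 1, 0], ![0, 0, 0, 0, 1], ![0, 1, 0, 0, 0],
        ![0, 0, 1, 0, 0]]) h
  rcases ne_or_eq a13 0 with h | rfl
  · exact step (b12 := a13) (b13 := 0) (b14 := a14) (b23 := -a23) (b24 := 0) (b34 := a24)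
      (.of_basis ![![1, 0, 0, 0, 0], ![0, 1, 0, 0, 0], ![0, 0, 0, 1, 0], ![0, 0, 1, 0, 0],
        ![0, 0, 0, 0, 1]]) h
  rcases ne_or_eq a14 0 with h | rfl
  · exact step (b12 := a14) (b13 := 0) (b14 := 0) (b23 := 0) (b24 := -a24) (b34 := -a23)
      (.of_basis ![![1, 0, 0, 0, 0], ![0, 1, 0, 0, 0], ![0, 0, 0, 0, 1], ![0, 0, 0, 1, 0],
        ![0, 0, 1, 0, 0]]) h
  have := hZ.coord_eq_zero ![0, 1, 0, 0, 0] 1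
  simp at this

/-- Five-dimensional algebras whose quotient by a central line has one-dimensional square. -/
theorem classify_five_L2 {a12 a13 a14 a23 a24 a34 : ℂ}
    (hZ : AnnLeSq (pr (1 : Fin 5) 2 3 + cen5 a12 a13 a14 a23 a24 a34)) :
    ∃ ν, Listed5 ν ∧ Iso (pr (1 : Fin 5) 2 3 + cen5 a12 a13 a14 a23 a24 a34) ν := by
  rcases ne_or_eq a34 0 with h | rfl
  · obtain ⟨p12, rfl⟩ := mul_right_surjective₀ h a12
    obtain ⟨p13, rfl⟩ := mul_right_surjective₀ h a13
    obtain ⟨p14, rfl⟩ := mul_right_surjective₀ h a14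
    obtain ⟨p23, rfl⟩ := mul_right_surjective₀ h a23
    obtain ⟨p24, rfl⟩ := mul_right_surjective₀ h a24
    exact ⟨_, .M1, .of_basis ![![a34, 0, 0, 0, 0], ![0, 1, 0, -p14, p13], ![0, 0, 1, -p24, p23],
      ![a34 * (p12 + p23 * p14 - p13 * p24), 0, 0, 1, 0], ![0, 0, 0, 0, 1]]⟩
  have key : ∀ a12 a13 a14 a23 a24 : ℂ, a13 ≠ 0 →
      AnnLeSq (pr (1 : Fin 5) 2 3 + cen5 a12 a13 a14 a23 a24 0) →
      Iso (pr (1 : Fin 5) 2 3 + cen5 a12 a13 a14 a23 a24 0)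
        (pr (1 : Fin 5) 2 3 + pr 1 3 5 + pr 2 4 5) := by
    intro a12 a13 a14 a23 a24 h hZ
    obtain ⟨p14, rfl⟩ := mul_right_surjective₀ h a14
    obtain ⟨p23, rfl⟩ := mul_right_surjective₀ h a23
    -- `e₄ - p14 e₃` annihilates `e₁`, and `e₂` times it is `a13 d e₅`; for `d = 0` it is central.
    obtain ⟨d, rfl⟩ : ∃ d, a24 = a13 * (d + p23 * p14) := by
      obtain ⟨p24, rfl⟩ := mul_right_surjective₀ h a24
      exact ⟨p24 - p23 * p14, by ring⟩
    rcases ne_or_eq d 0 with hd | rfl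
    · exact .of_basis ![![a13 * d ^ 2, 0, 0, 0, 0], ![0, d, 0, 0, 0], ![0, -p23, 1, 0, 0],
        ![a12 * d, 0, 0, d, 0], ![0, 0, 0, -p14 * d, d]]
    · have := hZ.coord_eq_zero ![0, 0, 0, -p14, 1] 4
      simp at this
  rcases ne_or_eq a13 0 with h | rfl
  · exact ⟨_, .L5, key _ _ _ _ _ h hZ⟩
  rcases ne_or_eq a23 0 with h | rfl
  · have e : Iso (pr (1 : Fin 5) 2 3 + cen5 a12 0 a14 a23 a24 0)
        (pr 1 2 3 + cen5 (-a12) (-a23) a24 0 a14 0) :=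
      .of_basis ![![1, 0, 0, 0, 0], ![0, 0, 1, 0, 0], ![0, 1, 0, 0, 0], ![0, 0, 0, -1, 0],
        ![0, 0, 0, 0, 1]]
    exact ⟨_, .L5, e.trans (key _ _ _ _ _ (neg_ne_zero.2 h) (e.annLeSq hZ))⟩
  rcases ne_or_eq a14 0 with h | rfl
  · exact ⟨_, .L8, .of_basis ![![a14, 0, 0, 0, 0], ![0, 1, 0, 0, 0], ![0, -a24 / a14, 1, 0, 0],
      ![0, 0, 0, 0, 1], ![a12, 0, 0, 1, 0]]⟩
  rcases ne_or_eq a24 0 with h | rfl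
  · exact ⟨_, .L8, .of_basis ![![a24, 0, 0, 0, 0], ![0, 0, 1, 0, 0], ![0, 1, 0, 0, 0],
      ![0, 0, 0, 0, 1], ![-a12, 0, 0, -1, 0]]⟩
  have := hZ.coord_eq_zero ![0, 0, 0, 0, 1] 4
  simp at this

theorem classify_five_L3 {a12 a13 a14 a23 a24 a34 : ℂ}
    (hM : IsMalcev (pr (1 : Fin 5) 2 3 + pr 1 3 4 + cen5 a12 a13 a14 a23 a24 a34))
    (hZ : AnnLeSq (pr (1 : Fin 5) 2 3 + pr 1 3 4 + cen5 a12 a13 a14 a23 a24 a34)) :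
    ∃ ν, Listed5 ν ∧ Iso (pr (1 : Fin 5) 2 3 + pr 1 3 4 + cen5 a12 a13 a14 a23 a24 a34) ν := by
  -- The Malcev identity at chosen vectors is compared in the new central coordinate. The copy `ν`
  -- is opaque, so its products evaluate only through the coordinate formulas `h`.
  obtain ⟨ν, hν, h⟩ := hM.exists_copy
  simp [Fin.forall_fin_succ, pr_apply] at h
  have h1 := congrFun (hν.2 ![0, 1, 0, 0, 0] ![0, 0, 1, 0, 0] ![0, 0, 1, 0, 0]) 0
  have h2 := congrFun (hν.2 ![0, 1, 0, 0, 0] ![0, 0, 1, 0, 0] ![0, 0, 0, 1, 0]) 0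
  simp [jac, h] at h1 h2
  clear h
  subst h1 h2
  rcases ne_or_eq a14 0 with h | rfl <;> rcases ne_or_eq a23 0 with h' | rfl
  -- Scaling `e₁` by `s` and `e₂` by `t` equalises the two coefficients when `t a23 = s² a14`; the
  -- choice `s = a23` avoids division.
  · exact ⟨_, .L6, .of_basis ![![a23 ^ 4 * a14 ^ 2, 0, 0, 0, 0], ![0, a23, 0, 0, 0],
      ![0, 0, a23 * a14, 0, 0], ![a23 ^ 2 * a14 * a12, 0, 0, a23 ^ 2 * a14, 0],
      ![a23 ^ 3 * a14 * a13, 0, 0, 0, a23 ^ 3 * a14]]⟩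
  · exact ⟨_, .L7, .of_basis ![![a14, 0, 0, 0, 0], ![0, 1, 0, 0, 0],
      ![0, 0, 1, 0, 0], ![a12, 0, 0, 1, 0], ![a13, 0, 0, 0, 1]]⟩
  · exact ⟨_, .L9, .of_basis ![![a23, 0, 0, 0, 0], ![0, 1, 0, 0, 0],
      ![0, 0, 1, 0, 0], ![a12, 0, 0, 1, 0], ![a13, 0, 0, 0, 1]]⟩
  · have := hZ.dotProduct_eq_zero ![1, 0, 0, 0, 0] ![1, 0, 0, -a12, -a13]
    simp [Fin.sum_univ_succ] at this

theorem classify_five {V : Type*} [AddCommGroup V] [Module ℂ V] {μ : Alg V}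
    (hV : Module.finrank ℂ V = 5) (hN : IsNilp μ) (hM : IsMalcev μ) :
    ∃ ν, Listed5 ν ∧ Iso μ ν := by
  have e2 : extend (pr (1 : Fin 4) 2 3) 0 = pr 1 2 3 := extend_pr _ _ _
  have e3 : extend (pr (1 : Fin 4) 2 3 + pr 1 3 4) 0 = pr 1 2 3 + pr 1 3 4 := by
    simp only [extend_add, extend_pr]
    rfl
  refine classify_extensions hV hN hM (fun W B hW => classify_four hW) ?_ ?_
  · rintro _ (_ | _ | _)
    · rw [extend_zero]
      exact .zero
    · rw [e2]
      exact .L2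
    · rw [e3]
      exact .L3
  · intro B hB θ hθ
    obtain ⟨a12, a13, a14, a23, a24, a34, h⟩ := extend_eq_five (B := B) hθ
    rw [h]
    cases hB with
    | zero =>
      rw [extend_zero, zero_add]
      exact fun _ hZ => ⟨_, .L4, classify_five_abelian hZ⟩
    | L2 =>
      rw [e2]
      exact fun _ hZ => classify_five_L2 hZ
    | L3 =>
      rw [e3]
      exact classify_five_L3

end LowDimension
end NilpMalcev

namespace NilpMalcev

/-! ### Dimension six: extensions of each five-dimensional algebra. -/

section DimensionSix

/-- The products of a six-dimensional algebra with values in the line of `e₆`. -/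
def cen (a12 a13 a14 a15 a23 a24 a25 a34 a35 a45 : ℂ) : Alg (Fin 6 → ℂ) :=
  a12 • prd 1 2 6 + a13 • prd 1 3 6 + a14 • prd 1 4 6 + a15 • prd 1 5 6 + a23 • prd 2 3 6 +
    a24 • prd 2 4 6 + a25 • prd 2 5 6 + a34 • prd 3 4 6 + a35 • prd 3 5 6 + a45 • prd 4 5 6

@[simp]
theorem cen_apply (a12 a13 a14 a15 a23 a24 a25 a34 a35 a45 : ℂ) (x y : Fin 6 → ℂ) (l : Fin 6) :
    cen a12 a13 a14 a15 a23 a24 a25 a34 a35 a45 x y l = if l = 0 then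
      a12 * (x 1 * y 2 - x 2 * y 1) + a13 * (x 1 * y 3 - x 3 * y 1) +
      a14 * (x 1 * y 4 - x 4 * y 1) + a15 * (x 1 * y 5 - x 5 * y 1) +
      a23 * (x 2 * y 3 - x 3 * y 2) + a24 * (x 2 * y 4 - x 4 * y 2) +
      a25 * (x 2 * y 5 - x 5 * y 2) + a34 * (x 3 * y 4 - x 4 * y 3) +
      a35 * (x 3 * y 5 - x 5 * y 3) + a45 * (x 4 * y 5 - x 5 * y 4) else 0 := by
  have : (6 : Fin 6) = 0 := rfl
  simp only [cen, LinearMap.add_apply, LinearMap.smul_apply, Pi.add_apply, Pi.smul_apply,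
    prd_apply, smul_eq_mul, this]
  split_ifs <;> ring

theorem extend_eq_six {B : Alg (Fin 5 → ℂ)} {θ : (Fin 5 → ℂ) →ₗ[ℂ] (Fin 5 → ℂ) →ₗ[ℂ] ℂ}
    (hθ : ∀ x y, θ x y = -θ y x) : ∃ a12 a13 a14 a15 a23 a24 a25 a34 a35 a45 : ℂ,
      extend B θ = extend B 0 + cen a12 a13 a14 a15 a23 a24 a25 a34 a35 a45 := by
  obtain ⟨t, ht, h⟩ := exists_skew_matrix hθ
  refine ⟨t 1 2, t 1 3, t 1 4, t 1 0, t 2 3, t 2 4, t 2 0, t 3 4, t 3 0, t 4 0,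
    LinearMap.ext₂ fun x y => funext fun j => ?_⟩
  simp only [Fin.forall_fin_succ] at ht
  revert j
  simp [Fin.forall_fin_succ, Fin.sum_univ_succ, extend_apply, h, up] at ht ⊢
  grind

/-- The classification holds for `μ`, if it is a Malcev algebra with annihilator in its square. -/
def Classified (μ : Alg (Fin 6 → ℂ)) : Prop :=
  IsMalcev μ → AnnLeSq μ → ∃ ν, IsListed ν ∧ Iso μ ν

theorem Classified.of_iso {μ ν : Alg (Fin 6 → ℂ)} (h : Classified ν) (e : Iso μ ν) :
    Classified μ := fun hM hZ => by
  obtain ⟨ξ, hξ, e'⟩ := h (e.isMalcev hM) (e.annLeSq hZ)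
  exact ⟨ξ, hξ, e.trans e'⟩

theorem IsListed.classified {μ ν : Alg (Fin 6 → ℂ)} (h : IsListed ν) (e : Iso μ ν) :
    Classified μ := fun _ _ => ⟨ν, h, e⟩

/-! ### Extensions of `L2`. -/

section L2

theorem classified_L2_of_a34 {a12 a13 a14 a15 a23 a24 a25 a34 a35 a45 : ℂ} (h : a34 ≠ 0) :
    Classified (prd 1 2 3 + cen a12 a13 a14 a15 a23 a24 a25 a34 a35 a45) := by
  obtain ⟨p12, rfl⟩ := mul_right_surjective₀ h a12
  obtain ⟨p13, rfl⟩ := mul_right_surjective₀ h a13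
  obtain ⟨p14, rfl⟩ := mul_right_surjective₀ h a14
  obtain ⟨p15, rfl⟩ := mul_right_surjective₀ h a15
  obtain ⟨p23, rfl⟩ := mul_right_surjective₀ h a23
  obtain ⟨p24, rfl⟩ := mul_right_surjective₀ h a24
  obtain ⟨p25, rfl⟩ := mul_right_surjective₀ h a25
  obtain ⟨p35, rfl⟩ := mul_right_surjective₀ h a35
  obtain ⟨p45, rfl⟩ := mul_right_surjective₀ h a45
  -- With `e₃e₄` as pivot, `e₅ + p45 e₃ - p35 e₄` annihilates `e₃` and `e₄`; only its products with
  -- `e₁` and `e₂` survive.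
  suffices key : ∀ b15 b25 : ℂ, Classified (prd 1 2 3 + cen 0 0 0 b15 0 0 b25 1 0 0) from
    (key (p15 + p13 * p45 - p14 * p35) (p25 + p23 * p45 - p24 * p35)).of_iso
      (.of_basis ![![a34, 0, 0, 0, 0, 0], ![0, 1, 0, -p14, p13, 0], ![0, 0, 1, -p24, p23, 0],
        ![a34 * (p12 + p14 * p23 - p13 * p24), 0, 0, 1, 0, 0], ![0, 0, 0, 0, 1, 0],
        ![0, 0, 0, p45, -p35, 1]])
  intro b15 b25
  rcases ne_or_eq b15 0 with h | rfl
  · exact IsListed.M5.classified (.of_basis ![![b15, 0, 0, 0, 0, 0], ![0, 1, 0, 0, 0, 0],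
      ![0, -b25, b15, 0, 0, 0], ![0, 0, 0, b15, 0, 0], ![0, 0, 0, 0, 1, 0], ![0, 0, 0, 0, 0, 1]])
  rcases ne_or_eq b25 0 with h | rfl
  · exact IsListed.M5.classified (.of_basis ![![b25, 0, 0, 0, 0, 0], ![0, 0, 1, 0, 0, 0],
      ![0, 1, 0, 0, 0, 0], ![0, 0, 0, -1, 0, 0], ![0, 0, 0, 0, -b25, 0], ![0, 0, 0, 0, 0, 1]])
  intro _ hZ
  have := hZ.coord_eq_zero ![0, 0, 0, 0, 0, 1] 5
  simp at this

theorem classified_L2_of_a13 {a12 a13 a14 a15 a23 a24 a25 a45 : ℂ} (h : a13 ≠ 0) :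
    Classified (prd 1 2 3 + cen a12 a13 a14 a15 a23 a24 a25 0 0 a45) := by
  obtain ⟨p14, rfl⟩ := mul_right_surjective₀ h a14
  obtain ⟨p15, rfl⟩ := mul_right_surjective₀ h a15
  obtain ⟨p23, rfl⟩ := mul_right_surjective₀ h a23
  obtain ⟨p24, rfl⟩ := mul_right_surjective₀ h a24
  obtain ⟨p25, rfl⟩ := mul_right_surjective₀ h a25
  obtain ⟨p45, rfl⟩ := mul_right_surjective₀ h a45
  suffices key : ∀ b24 b25 b45 : ℂ,
      Classified (prd 1 2 3 + cen 0 1 0 0 0 b24 b25 0 0 b45) from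
    (key (p24 - p14 * p23) (p25 - p15 * p23) p45).of_iso
      (.of_basis ![![a13, 0, 0, 0, 0, 0], ![0, 1, 0, 0, 0, 0], ![0, -p23, 1, 0, 0, 0],
        ![a12, 0, 0, 1, 0, 0], ![0, 0, 0, -p14, 1, 0], ![0, 0, 0, -p15, 0, 1]])
  intro b24 b25 b45
  rcases ne_or_eq b45 0 with h | rfl
  · exact IsListed.L10.classified (.of_basis ![![1, 0, 0, 0, 0, 0], ![0, 1, 0, 0, 0, 0],
      ![0, 0, 1, 0, -b25 / b45, b24 / b45], ![0, 0, 0, 1, 0, 0], ![0, 0, 0, 0, 1, 0],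
      ![0, 0, 0, 0, 0, b45⁻¹]])
  intro _ hZ
  have h4 := hZ.coord_eq_zero ![0, 0, 0, 0, b25, -b24] 4
  have h5 := hZ.coord_eq_zero ![0, 0, 0, 0, b25, -b24] 5
  simp at h4 h5
  subst h4 h5
  have := hZ.coord_eq_zero ![0, 0, 0, 0, 0, 1] 5
  simp at this

/-- Here `e₃` is central, so the product is a pair of skew forms on the span of `e₁, e₂, e₄, e₅`,
the first of rank two with radical spanned by `e₄, e₅`. The second form restricted to that radical
is `a45`, which separates the two cases. -/
theorem classified_L2_of_central {a12 a14 a15 a24 a25 a45 : ℂ} :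
    Classified (prd 1 2 3 + cen a12 0 a14 a15 0 a24 a25 0 0 a45) := by
  rcases ne_or_eq a45 0 with h | rfl
  · obtain ⟨p12, rfl⟩ := mul_right_surjective₀ h a12
    obtain ⟨p14, rfl⟩ := mul_right_surjective₀ h a14
    obtain ⟨p15, rfl⟩ := mul_right_surjective₀ h a15
    obtain ⟨p24, rfl⟩ := mul_right_surjective₀ h a24
    obtain ⟨p25, rfl⟩ := mul_right_surjective₀ h a25
    suffices key : Classified (prd 1 2 3 + cen 0 0 0 0 0 0 0 0 0 1) from
      key.of_iso (.of_basis ![![a45, 0, 0, 0, 0, 0], ![0, 1, 0, 0, -p15, p14],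
        ![0, 0, 1, 0, -p25, p24], ![a45 * (p12 - p25 * p14 + p24 * p15), 0, 0, 1, 0, 0],
        ![0, 0, 0, 0, 1, 0], ![0, 0, 0, 0, 0, 1]])
    -- The algebra is a sum of two Heisenberg algebras; the basis consists of sums and differences
    -- of corresponding vectors.
    exact IsListed.L22b.classified (.of_basis ![![-1, 0, 0, 1, 0, 0], ![0, 1, 0, 0, 1, 0],
      ![0, 0, 1, 0, 0, 1], ![0, 0, 1, 0, 0, -1], ![0, -1, 0, 0, 1, 0], ![1, 0, 0, 1, 0, 0]])
  obtain ⟨d, hd⟩ : ∃ d, d = a14 * a25 - a15 * a24 := ⟨_, rfl⟩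
  rcases ne_or_eq d 0 with h | rfl
  · exact IsListed.L22a.classified (.of_basis ![![a12, 0, 0, 1, 0, 0], ![0, 1, 0, 0, 0, 0],
      ![0, 0, 0, 0, a25, -a24], ![0, 0, 1, 0, 0, 0], ![0, 0, 0, 0, -a15, a14],
      ![d, 0, 0, 0, 0, 0]])
  intro _ hZ
  have h1 := hZ.coord_eq_zero ![0, 0, 0, 0, a25, -a24] 4
  have h2 := hZ.coord_eq_zero ![0, 0, 0, 0, a25, -a24] 5
  have h3 := hZ.coord_eq_zero ![0, 0, 0, 0, a15, -a14] 4
  have h4 := hZ.coord_eq_zero ![0, 0, 0, 0, a15, -a14] 5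
  simp at h1 h2 h3 h4
  subst h1 h2 h3 h4
  have := hZ.coord_eq_zero ![0, 0, 0, 0, 0, 1] 5
  simp at this

theorem classified_L2 (a12 a13 a14 a15 a23 a24 a25 a34 a35 a45 : ℂ) :
    Classified (prd 1 2 3 + cen a12 a13 a14 a15 a23 a24 a25 a34 a35 a45) := by
  rcases ne_or_eq a34 0 with h | rfl
  · exact classified_L2_of_a34 h
  rcases ne_or_eq a35 0 with h | rfl
  · exact (classified_L2_of_a34 (a12 := a12) (a13 := a13) (a14 := a15) (a15 := a14) (a23 := a23)
      (a24 := a25) (a25 := a24) (a35 := 0) (a45 := -a45) h).of_iso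
      (.of_basis ![![1, 0, 0, 0, 0, 0], ![0, 1, 0, 0, 0, 0], ![0, 0, 1, 0, 0, 0],
        ![0, 0, 0, 1, 0, 0], ![0, 0, 0, 0, 0, 1], ![0, 0, 0, 0, 1, 0]])
  rcases ne_or_eq a13 0 with h | rfl
  · exact classified_L2_of_a13 h
  rcases ne_or_eq a23 0 with h | rfl
  · exact (classified_L2_of_a13 (a12 := -a12) (a14 := a24) (a15 := a25) (a23 := 0)
      (a24 := a14) (a25 := a15) (a45 := a45) (neg_ne_zero.2 h)).of_iso
      (.of_basis ![![1, 0, 0, 0, 0, 0], ![0, 0, 1, 0, 0, 0], ![0, 1, 0, 0, 0, 0],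
        ![0, 0, 0, -1, 0, 0], ![0, 0, 0, 0, 1, 0], ![0, 0, 0, 0, 0, 1]])
  exact classified_L2_of_central

end L2

/-! ### Extensions of `L3`. -/

section L3

/-- The vector `a14 e₅ - a15 e₄` annihilates `e₁`. Its products with `e₃` and `e₂` decide the type,
and it is central if both vanish. -/
theorem classified_L3_of_a14 {a14 a15 a23 a25 a35 : ℂ} (h : a14 ≠ 0) :
    Classified (prd 1 2 3 + prd 1 3 4 + cen 0 0 a14 a15 a23 0 a25 0 a35 0) := by
  rcases ne_or_eq a35 0 with h' | rfl
  · exact IsListed.M6.classified (.of_basis ![![a14, 0, 0, 0, 0, 0], ![0, 1, 0, 0, 0, 0],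
      ![0, 0, 1, -a25 / a35, 0, a23 / a35], ![a23 / a35 * a15, 0, 0, 1, -a25 / a35, 0],
      ![-a25 / a35 * a14, 0, 0, 0, 1, 0], ![0, 0, 0, 0, -a15 / a35, a14 / a35]])
  rcases ne_or_eq a25 0 with h' | rfl
  · rcases ne_or_eq a23 0 with h'' | rfl
    · exact IsListed.L11.classified (.of_basis ![![a23 ^ 4 * a14 ^ 2, 0, 0, 0, 0, 0],
        ![0, a23, 0, 0, 0, 0], ![0, 0, a23 * a14, 0, 0, 0], ![0, 0, 0, a23 ^ 2 * a14, 0, 0],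
        ![0, 0, 0, 0, a23 ^ 3 * a14, 0],
        ![0, 0, 0, 0, -a15 * a23 ^ 3 / a25, a14 * a23 ^ 3 / a25]])
    · exact IsListed.L12.classified (.of_basis ![![a14, 0, 0, 0, 0, 0],
        ![0, 1, 0, 0, 0, 0], ![0, 0, 1, 0, 0, 0], ![0, 0, 0, 1, 0, 0],
        ![0, 0, 0, 0, 1, 0], ![0, 0, 0, 0, -a15 / a25, a14 / a25]])
  intro _ hZ
  have := hZ.coord_eq_zero ![0, 0, 0, 0, -a15, a14] 5
  simp at this
  exact absurd this h

theorem classified_L3_of_central {a15 a23 a25 a35 : ℂ} :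
    Classified (prd 1 2 3 + prd 1 3 4 + cen 0 0 0 a15 a23 0 a25 0 a35 0) := by
  rcases ne_or_eq a35 0 with h | rfl
  · obtain ⟨p15, rfl⟩ := mul_right_surjective₀ h a15
    obtain ⟨p23, rfl⟩ := mul_right_surjective₀ h a23
    obtain ⟨p25, rfl⟩ := mul_right_surjective₀ h a25
    exact IsListed.M2.classified (.of_basis ![![0, 0, 0, 0, 1, 0], ![0, 1, 0, -p15, 0, 0],
      ![0, 0, 1, -p25, 0, p23], ![a35 * p15 * p23, 0, 0, 1, -p25, 0], ![0, 0, 0, 0, 0, 1],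
      ![a35, 0, 0, 0, 0, 0]])
  rcases ne_or_eq a25 0 with h | rfl
  · obtain ⟨p15, rfl⟩ := mul_right_surjective₀ h a15
    rcases ne_or_eq a23 0 with h' | rfl
    -- The new `e₁, e₂` are chosen so that their products with the old `e₅` are `±a25² e₆`; adding
    -- `4 a23 e₅` to the new `e₃` then exchanges its products with them, which gives the new `e₄`.
    · exact IsListed.L24b.classified (.of_basis ![
        ![2 * a25 * p15 * a23 + 2 * a25 ^ 2 * a23, 0, 0, 0, -2 * a25, 0],
        ![0, 1, a25 - p15, 0, 0, 0], ![0, 1, -a25 - p15, 0, 0, 0], ![0, 0, 0, -2 * a25, 0, 0],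
        ![0, 0, 0, -2 * a25, 0, 4 * a23],
        ![2 * a25 * p15 * a23 - 2 * a25 ^ 2 * a23, 0, 0, 0, -2 * a25, 0]])
    · exact IsListed.L19a.classified (.of_basis ![![0, 0, 0, 0, -1, 0], ![0, 0, 1, 0, 0, 0],
        ![0, 1, -p15, 0, 0, 0], ![0, 0, 0, 0, 0, 1], ![0, 0, 0, -1, 0, 0],
        ![a25, 0, 0, 0, 0, 0]])
  rcases ne_or_eq a15 0 with h | rfl
  · rcases ne_or_eq a23 0 with h' | rfl
    · exact IsListed.L24a.classified (.of_basis ![![0, 0, 0, 0, -1, 0], ![0, 0, 1, 0, 0, 0],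
        ![0, 1, 0, 0, 0, 0], ![0, 0, 0, -1, 0, 0], ![0, 0, 0, 0, 0, -a23 / a15],
        ![-a23, 0, 0, 0, 0, 0]])
    · exact IsListed.L25.classified (.of_basis ![![a15, 0, 0, 0, 0, 0], ![0, 1, 0, 0, 0, 0],
        ![0, 0, 1, 0, 0, 0], ![0, 0, 0, 1, 0, 0], ![0, 0, 0, 0, 0, 1], ![0, 0, 0, 0, 1, 0]])
  intro _ hZ
  have := hZ.coord_eq_zero ![0, 0, 0, 0, 0, 1] 5
  simp at this

theorem classified_L3 (a12 a13 a14 a15 a23 a24 a25 a34 a35 a45 : ℂ) : Classified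
    (prd 1 2 3 + prd 1 3 4 + cen a12 a13 a14 a15 a23 a24 a25 a34 a35 a45) := by
  intro hM
  obtain ⟨ν, hν, h⟩ := hM.exists_copy
  simp [Fin.forall_fin_succ, prd_apply] at h
  have h1 := congrFun (hν.2 ![0, 1, 0, 0, 0, 0] ![0, 0, 1, 0, 0, 0] ![0, 0, 1, 0, 0, 0]) 0
  have h2 := congrFun (hν.2 ![0, 1, 0, 0, 0, 0] ![0, 0, 1, 0, 0, 0] ![0, 0, 0, 1, 0, 0]) 0
  have h3 := congrFun (hν.2 ![0, 1, 0, 0, 0, 0] ![0, 0, 0, 0, 0, 1] ![0, 0, 1, 0, 0, 0]) 0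
  simp [jac, h] at h1 h2 h3
  clear h
  subst h1 h2 h3
  suffices key : Classified (prd 1 2 3 + prd 1 3 4 + cen 0 0 a14 a15 a23 0 a25 0 a35 0) from
    key.of_iso (.of_basis ![![1, 0, 0, 0, 0, 0], ![0, 1, 0, 0, 0, 0], ![0, 0, 1, 0, 0, 0],
      ![a12, 0, 0, 1, 0, 0], ![a13, 0, 0, 0, 1, 0], ![0, 0, 0, 0, 0, 1]]) hM
  rcases ne_or_eq a14 0 with h | rfl
  · exact classified_L3_of_a14 h
  · exact classified_L3_of_central

end L3
end DimensionSix
end NilpMalcev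

namespace NilpMalcev

section DimensionSix

/-! ### Extensions of `L8`. -/

section L8

theorem classified_L8_of_zero {a14 a15 a23 : ℂ} :
    Classified (prd 1 2 4 + prd 1 3 5 + cen 0 0 a14 a15 a23 0 0 0 0 0) := by
  have key : ∀ a14 a15 a23 : ℂ, a14 ≠ 0 →
      Classified (prd 1 2 4 + prd 1 3 5 + cen 0 0 a14 a15 a23 0 0 0 0 0) := by
    intro a14 a15 a23 h
    obtain ⟨p15, rfl⟩ := mul_right_surjective₀ h a15
    rcases ne_or_eq a23 0 with h' | rfl
    · exact IsListed.L23.classified (.of_basis ![![0, 0, 0, 0, -p15 * a14 / a23, a14 / a23],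
        ![0, 1, 0, 0, 0, 0], ![0, 0, 1, 0, 0, 0], ![0, 0, 0, 0, 1, 0],
        ![0, 0, -p15 * a14 / a23, a14 / a23, 0, 0], ![a14, 0, 0, 0, 0, 0]])
    · exact IsListed.L25.classified (.of_basis ![![0, 0, 0, 0, -p15, 1],
        ![0, 1, 0, 0, 0, 0], ![0, 0, 1, 0, 0, 0], ![0, 0, 0, 0, 1, 0],
        ![0, 0, -p15, 1, 0, 0], ![a14, 0, 0, 0, 0, 0]])
  rcases ne_or_eq a14 0 with h | rfl
  · exact key _ _ _ h
  rcases ne_or_eq a15 0 with h | rfl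
  · exact (key a15 0 (-a23) h).of_iso (.of_basis ![![1, 0, 0, 0, 0, 0],
      ![0, 1, 0, 0, 0, 0], ![0, 0, 0, 1, 0, 0], ![0, 0, 1, 0, 0, 0], ![0, 0, 0, 0, 0, 1],
      ![0, 0, 0, 0, 1, 0]])
  rcases ne_or_eq a23 0 with h | rfl
  · exact IsListed.L26.classified (.of_basis ![![a23, 0, 0, 0, 0, 0],
      ![0, 1, 0, 0, 0, 0], ![0, 0, 1, 0, 0, 0], ![0, 0, 0, 1, 0, 0], ![0, 0, 0, 0, 1, 0],
      ![0, 0, 0, 0, 0, 1]])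
  intro _ hZ
  have := hZ.coord_eq_zero ![1, 0, 0, 0, 0, 0] 0
  simp at this

theorem classified_L8_of_skew {a14 a15 a23 k : ℂ} (h : k ≠ 0) :
    Classified (prd 1 2 4 + prd 1 3 5 + cen 0 0 a14 a15 a23 0 k (-k) 0 0) := by
  obtain ⟨p14, rfl⟩ := mul_right_surjective₀ h a14
  obtain ⟨p15, rfl⟩ := mul_right_surjective₀ h a15
  obtain ⟨p23, rfl⟩ := mul_right_surjective₀ h a23
  exact IsListed.M8.classified (.of_basis ![![k, 0, 0, 0, 0, 0], ![0, 1, -p15, p14, 0, 0],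
    ![0, 0, 1, 0, -p23, 0], ![0, 0, 0, 1, 0, 0], ![-k * p14 * p23, 0, 0, 0, 1, 0],
    ![-k * p15 * p23, 0, 0, 0, 0, 1]])

theorem classified_L8_of_generic {a14 a15 a23 α : ℂ} :
    Classified (prd 1 2 4 + prd 1 3 5 + cen 0 0 a14 a15 a23 1 1 (-1) α 0) := by
  rcases ne_or_eq α (-1) with h | rfl
  -- `1 + α` is the determinant of the form `(1, 1; -1, α)` pairing `e₂, e₃` with `e₄, e₅`; when it
  -- is nonzero, shifting `e₁` by `e₂` and `e₃` removes `a14` and `a15`.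
  · have h' : 1 + α ≠ 0 := fun h' => h (by linear_combination h')
    obtain ⟨t, ht⟩ : ∃ t, t * (1 + α) = a14 - a15 := ⟨(a14 - a15) / (1 + α), by field_simp⟩
    obtain rfl : a15 = a14 - t * (1 + α) := by rw [ht]; ring
    exact (IsListed.M7 α h).classified (.of_basis ![![1, 0, 0, 0, 0, 0],
      ![0, 1, t - a14, t, 0, 0], ![0, 0, 1, 0, -a23, 0], ![0, 0, 0, 1, 0, 0],
      ![-t * a23, 0, 0, 0, 1, 0], ![(t - a14) * a23, 0, 0, 0, 0, 1]])
  -- For `α = -1` such shifts change `a14` and `a15` by the same amount, so their difference `b`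
  -- survives.
  obtain ⟨b, rfl⟩ : ∃ b, a14 = a15 + b := ⟨a14 - a15, by ring⟩
  rcases ne_or_eq b 0 with h | rfl
  · exact IsListed.M9.classified (.of_basis ![![b, 0, 0, 0, 0, 0],
      ![0, 1, -(2 * a15 + b) / 4, (2 * a15 + b) / 4, 0, 0], ![0, 0, 1, -1, 0, 0],
      ![0, 0, b / 4, b / 4, -a23 * b / 8, -a23 * b / 8], ![0, 0, 0, 0, 1, -1],
      ![-(2 * a15 + b) * a23 * b / 8, 0, 0, 0, b / 4, b / 4]])
  · exact IsListed.M3.classified (.of_basis ![![0, 0, 0, 0, 1, -1],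
      ![0, 1, -a15 / 2, a15 / 2, 0, 0], ![0, 0, 1, 1, -a23 / 2, -a23 / 2],
      ![-a15 * a23, 0, 0, 0, 1, 1], ![0, 0, 1, -1, 0, 0], ![-4, 0, 0, 0, 0, 0]])

theorem classified_L8_of_a24 {a14 a15 a23 a24 a25 a34 a35 : ℂ} (h : a24 ≠ 0) :
    Classified (prd 1 2 4 + prd 1 3 5 + cen 0 0 a14 a15 a23 a24 a25 a34 a35 0) := by
  suffices key : ∀ a14 a15 a23 k d : ℂ,
      Classified (prd 1 2 4 + prd 1 3 5 + cen 0 0 a14 a15 a23 1 k (-k) d 0) by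
    obtain ⟨p14, rfl⟩ := mul_right_surjective₀ h a14
    obtain ⟨p15, rfl⟩ := mul_right_surjective₀ h a15
    obtain ⟨p23, rfl⟩ := mul_right_surjective₀ h a23
    obtain ⟨p35, rfl⟩ := mul_right_surjective₀ h a35
    -- `s` and `k` are the symmetric and skew off-diagonal parts; `e₃ - s e₂` completes the square
    -- and leaves `k` alone.
    obtain ⟨s, k, rfl, rfl⟩ : ∃ s k, a25 = a24 * (s + k) ∧ a34 = a24 * (s - k) := by
      obtain ⟨p25, rfl⟩ := mul_right_surjective₀ h a25
      obtain ⟨p34, rfl⟩ := mul_right_surjective₀ h a34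
      exact ⟨(p25 + p34) / 2, (p25 - p34) / 2, by ring, by ring⟩
    exact (key p14 (p15 - s * p14) p23 k (p35 - s ^ 2)).of_iso
      (.of_basis ![![a24, 0, 0, 0, 0, 0], ![0, 1, 0, 0, 0, 0], ![0, 0, 1, 0, 0, 0],
        ![0, 0, -s, 1, 0, 0], ![0, 0, 0, 0, 1, 0], ![0, 0, 0, 0, -s, 1]])
  intro a14 a15 a23 k d
  rcases ne_or_eq k 0 with h | rfl
  · exact (classified_L8_of_generic (a14 := a14) (a15 := a15 / k) (a23 := a23 / k)
      (α := d / k ^ 2)).of_iso (.of_basis ![![1, 0, 0, 0, 0, 0], ![0, 1, 0, 0, 0, 0],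
        ![0, 0, 1, 0, 0, 0], ![0, 0, 0, 1 / k, 0, 0], ![0, 0, 0, 0, 1, 0],
        ![0, 0, 0, 0, 0, 1 / k]])
  obtain ⟨r, hr⟩ := IsAlgClosed.exists_pow_nat_eq d (n := 2) (by norm_num)
  subst hr
  rcases ne_or_eq r 0 with h | rfl
  · exact IsListed.L19b.classified (.of_basis ![![1, 0, 0, 0, 0, 0],
      ![0, 1, -a14, -a15 / r ^ 2, 0, 0], ![0, 0, 1, 0, 0, 0], ![0, 0, 0, 1 / r, -a23 / r, 0],
      ![a15 / r ^ 2 * a23, 0, 0, 0, 1, 0], ![-a14 * a23 / r, 0, 0, 0, 0, 1 / r]])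
  rcases ne_or_eq a15 0 with h | rfl
  · exact IsListed.L20.classified (.of_basis ![![1, 0, 0, 0, 0, 0],
      ![0, 1, -a14, 0, 0, 0], ![0, 0, 1, 0, 0, 0], ![0, 0, 0, 1 / a15, -a23 / a15, 0],
      ![0, 0, 0, 0, 1, 0], ![-a14 * a23 / a15, 0, 0, 0, 0, 1 / a15]])
  · exact IsListed.L19a.classified (.of_basis ![![1, 0, 0, 0, 0, 0],
      ![0, 1, -a14, 0, 0, 0], ![0, 0, 1, 0, 0, 0], ![0, 0, 0, 1, -a23, 0],
      ![0, 0, 0, 0, 1, 0], ![-a14 * a23, 0, 0, 0, 0, 1]])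

/-- After the Malcev identity removes `a45`, the core datum is the `2 × 2` form with entries `a24,
a25, a34, a35`. Since `e₄` and `e₅` are the products of `e₁` with `e₂` and `e₃`, a change of `e₂,
e₃` acts on it by congruence; unless the form is alternating, `a24 ≠ 0` can be arranged. -/
theorem classified_L8 (a12 a13 a14 a15 a23 a24 a25 a34 a35 a45 : ℂ) : Classified
    (prd 1 2 4 + prd 1 3 5 + cen a12 a13 a14 a15 a23 a24 a25 a34 a35 a45) := by
  intro hM
  obtain ⟨ν, hν, h⟩ := hM.exists_copy
  simp [Fin.forall_fin_succ, prd_apply] at h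
  have h1 := congrFun (hν.2 ![0, 1, 0, 0, 0, 0] ![0, 0, 1, 0, 0, 0] ![0, 0, 0, 1, 0, 0]) 0
  simp [jac, h] at h1
  clear h
  subst h1
  suffices key : Classified (prd 1 2 4 + prd 1 3 5 + cen 0 0 a14 a15 a23 a24 a25 a34 a35 0) from
    key.of_iso (.of_basis ![![1, 0, 0, 0, 0, 0], ![0, 1, 0, 0, 0, 0], ![0, 0, 1, 0, 0, 0],
      ![0, 0, 0, 1, 0, 0], ![a12, 0, 0, 0, 1, 0], ![a13, 0, 0, 0, 0, 1]]) hM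
  rcases ne_or_eq a24 0 with h | rfl
  · exact classified_L8_of_a24 h
  rcases ne_or_eq a35 0 with h | rfl
  · exact (classified_L8_of_a24 (a14 := a15) (a15 := a14) (a23 := -a23) (a25 := a34) (a34 := a25)
      (a35 := 0) h).of_iso (.of_basis ![![1, 0, 0, 0, 0, 0], ![0, 1, 0, 0, 0, 0],
        ![0, 0, 0, 1, 0, 0], ![0, 0, 1, 0, 0, 0], ![0, 0, 0, 0, 0, 1], ![0, 0, 0, 0, 1, 0]])
  rcases ne_or_eq (a25 + a34) 0 with h | h
  · exact (classified_L8_of_a24 (a14 := a14 + a15) (a15 := a15) (a23 := a23) (a25 := a25)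
      (a34 := a34) (a35 := 0) h).of_iso (.of_basis ![![1, 0, 0, 0, 0, 0], ![0, 1, 0, 0, 0, 0],
        ![0, 0, 1, 1, 0, 0], ![0, 0, 0, 1, 0, 0], ![0, 0, 0, 0, 1, 1], ![0, 0, 0, 0, 0, 1]])
  obtain rfl : a34 = -a25 := by linear_combination h
  rcases ne_or_eq a25 0 with h | rfl
  · exact classified_L8_of_skew h
  · rw [neg_zero]
    exact classified_L8_of_zero

end L8

/-! ### Extensions of `L5`. -/

section L5

theorem classified_L5_of_a15 {a13 a14 a15 a23 a34 : ℂ} (h : a15 ≠ 0) :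
    Classified (prd 1 2 3 + prd 1 3 5 + prd 2 4 5 + cen 0 a13 a14 a15 a23 0 0 a34 0 0) := by
  suffices key : ∀ b c : ℂ,
      Classified (prd 1 2 3 + prd 1 3 5 + prd 2 4 5 + cen 0 0 0 1 b 0 0 c 0 0) by
    -- The shifts `e₁ + p13 e₄` and `e₂ - p13 e₃` each contribute `-p13 e₅` to the product `e₁e₂`,
    -- hence the factor two.
    obtain ⟨p13, rfl⟩ : ∃ p, a13 = 2 * p * a15 := ⟨a13 / (2 * a15), by field_simp⟩
    obtain ⟨p14, rfl⟩ := mul_right_surjective₀ h a14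
    obtain ⟨p23, rfl⟩ := mul_right_surjective₀ h a23
    obtain ⟨p34, rfl⟩ := mul_right_surjective₀ h a34
    exact (key p23 p34).of_iso (.of_basis ![![a15, 0, 0, 0, 0, 0],
      ![0, 1, 0, 0, p13, -p13 * p14], ![0, 0, 1, -p13, 0, 0],
      ![a15 * (p34 * p13 ^ 2 - 2 * p13 ^ 2), 0, 0, 1, 0, -2 * p13], ![0, 0, 0, 0, 1, -p14],
      ![-a15 * p13 * p34, 0, 0, 0, 0, 1]])
  have main : ∀ c : ℂ,
      Classified (prd 1 2 3 + prd 1 3 5 + prd 2 4 5 + cen 0 0 0 1 0 0 0 c 0 0) := by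
    intro c
    -- `J(e₁, e₂, e₄) = (c - 1) e₆`: the value `c = 1` is the Lie case, which the family `M12`
    -- omits.
    rcases ne_or_eq c 1 with h | rfl
    · exact (IsListed.M12 (-c) (by simpa using h)).classified (.of_basis ![![-1, 0, 0, 0, 0, 0],
        ![0, 0, 1, 0, 0, 0], ![0, 1, 0, 0, 0, 0], ![0, 0, 0, -1, 0, 0], ![0, 0, 0, 0, -1, 0],
        ![0, 0, 0, 0, 0, -1]])
    · exact IsListed.L13.classified (.of_basis ![![1, 0, 0, 0, 0, 0],
        ![0, 1, 0, 0, 0, 0], ![0, 0, 1, 0, 0, 0], ![0, 0, 0, 1, 0, 0], ![0, 0, 0, 0, 1, 0],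
        ![0, 0, 0, 0, 0, 1]])
  intro b c
  rcases ne_or_eq c 0 with h | rfl
  · exact (main c).of_iso (.of_basis ![![1, 0, 0, 0, 0, 0],
        ![0, 1, 0, 0, 0, 0], ![0, 0, 1, 0, b / c, 0], ![0, 0, 0, 1, 0, 0], ![0, 0, 0, 0, 1, 0],
        ![0, 0, 0, 0, 0, 1]])
  rcases ne_or_eq b 0 with h | rfl
  · exact IsListed.M13.classified (.of_basis ![![-b ^ 4, 0, 0, 0, 0, 0],
        ![0, 0, b, 0, 0, 0], ![0, b, 0, 0, 0, 0], ![0, 0, 0, -b ^ 2, 0, 0],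
        ![0, 0, 0, 0, -b ^ 2, 0], ![0, 0, 0, 0, 0, -b ^ 3]])
  · exact main 0

theorem classified_L5_of_central {a13 a14 a23 a34 : ℂ} :
    Classified (prd 1 2 3 + prd 1 3 5 + prd 2 4 5 + cen 0 a13 a14 0 a23 0 0 a34 0 0) := by
  rcases ne_or_eq a34 0 with h | rfl
  · obtain ⟨p13, rfl⟩ := mul_right_surjective₀ h a13
    obtain ⟨p14, rfl⟩ := mul_right_surjective₀ h a14
    obtain ⟨p23, rfl⟩ := mul_right_surjective₀ h a23
    exact IsListed.M4.classified (.of_basis ![![a34 * p13, 0, 0, 0, 0, 1],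
      ![0, 1, 0, -p14, 0, 0], ![0, 0, 1, p13, p23, 0],
      ![a34 * (p13 ^ 2 + p14 * p23), 0, 0, 1, 0, p13], ![0, 0, 0, 0, 1, 0],
      ![a34, 0, 0, 0, 0, 0]])
  rcases ne_or_eq a23 0 with h | rfl
  · obtain ⟨p13, rfl⟩ := mul_right_surjective₀ h a13
    -- The root makes the product of `e₁ - (c + p13) e₂` and `e₄ - c e₃` a multiple of `e₅ - c a23
    -- e₆`, so the algebra is an extension of `L3` by that line.
    obtain ⟨c, hc⟩ : ∃ c, a23 * (c * c) + p13 * a23 * c + -a14 = 0 := by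
      obtain ⟨r, hr⟩ := IsAlgClosed.exists_pow_nat_eq
        (discrim a23 (p13 * a23) (-a14)) (n := 2) (by norm_num)
      exact exists_quadratic_eq_zero h ⟨r, by rw [← hr, sq]⟩
    obtain rfl : a14 = a23 * (c * c) + p13 * a23 * c := by linear_combination -hc
    exact (classified_L3 0 0 0 1 (-1) 0 (-2 * c - p13) 0 0 0).of_iso
      (.of_basis ![![-c * a23, 0, 0, 0, 0, 1], ![0, 0, 1, 0, 0, 0],
        ![0, 1, -(c + p13), 0, 0, 0], ![0, 0, 0, -1, 0, 0], ![-a23, 0, 0, 0, 0, 0],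
        ![0, 0, 0, -c, 1, 0]])
  rcases ne_or_eq a13 0 with h | rfl
  · exact (classified_L3 0 0 0 (-a14) 0 0 a13 0 0 0).of_iso
      (.of_basis ![![0, 0, 0, 0, 0, 1], ![0, 1, 0, 0, 0, 0], ![0, 0, 1, 0, 0, 0],
        ![0, 0, 0, 1, 0, 0], ![a13, 0, 0, 0, 0, 1], ![0, 0, 0, -a14, a13, 0]])
  rcases ne_or_eq a14 0 with h | rfl
  · exact IsListed.L23.classified (.of_basis ![![a14, 0, 0, 0, 0, 0],
      ![0, 1, 0, 0, 0, 0], ![0, 0, 1, 0, 0, 0], ![0, 0, 0, 1, 0, 0],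
      ![0, 0, 0, 0, 1, 0], ![0, 0, 0, 0, 0, 1]])
  intro _ hZ
  have := hZ.coord_eq_zero ![1, 0, 0, 0, 0, 0] 0
  simp at this

theorem classified_L5 (a12 a13 a14 a15 a23 a24 a25 a34 a35 a45 : ℂ) : Classified
    (prd 1 2 3 + prd 1 3 5 + prd 2 4 5 + cen a12 a13 a14 a15 a23 a24 a25 a34 a35 a45) := by
  intro hM
  obtain ⟨ν, hν, h⟩ := hM.exists_copy
  simp [Fin.forall_fin_succ, prd_apply] at h
  have h1 := congrFun (hν.2 ![0, 1, 0, 0, 0, 0] ![0, 0, 1, 0, 0, 0] ![0, 0, 1, 0, 0, 0]) 0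
  have h2 := congrFun (hν.2 ![0, 1, 0, 0, 0, 0] ![0, 0, 1, 0, 0, 0] ![0, 0, 0, 1, 0, 0]) 0
  have h3 := congrFun (hν.2 ![0, 1, 0, 0, 0, 0] ![0, 0, 0, 0, 1, 0] ![0, 0, 1, 0, 0, 0]) 0
  simp [jac, h] at h1 h2 h3
  clear h
  subst h1 h2 h3
  suffices key : Classified (prd 1 2 3 + prd 1 3 5 + prd 2 4 5 +
      cen 0 (a13 - a24) a14 a15 a23 0 0 a34 0 0) from
    key.of_iso (.of_basis ![![1, 0, 0, 0, 0, 0], ![0, 1, 0, 0, 0, 0], ![0, 0, 1, 0, 0, 0],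
      ![a12, 0, 0, 1, 0, 0], ![0, 0, 0, 0, 1, 0], ![a24, 0, 0, 0, 0, 1]]) hM
  rcases ne_or_eq a15 0 with h | rfl
  · exact classified_L5_of_a15 h
  · exact classified_L5_of_central

end L5
end DimensionSix
end NilpMalcev

namespace NilpMalcev

section DimensionSix

/-! ### Extensions of `M1`. -/

section M1

theorem classified_M1_of_a13 {a13 a14 a23 a24 : ℂ} (h : a13 ≠ 0) :
    Classified (prd 1 2 3 + prd 3 4 5 + cen 0 a13 a14 0 a23 a24 0 0 0 0) := by
  obtain ⟨p14, rfl⟩ := mul_right_surjective₀ h a14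
  obtain ⟨p23, rfl⟩ := mul_right_surjective₀ h a23
  obtain ⟨d, rfl⟩ : ∃ d, a24 = a13 * (d + p23 * p14) := by
    obtain ⟨p24, rfl⟩ := mul_right_surjective₀ h a24
    exact ⟨p24 - p23 * p14, by ring⟩
  rcases ne_or_eq d 0 with h' | rfl
  · exact IsListed.M4.classified (.of_basis ![![a13, 0, 0, 0, 0, 0], ![0, 1, 0, 0, 0, 0],
      ![0, -p23, 1, 0, 0, 0], ![0, 0, 0, 1, 0, 0], ![0, 0, 0, -p14 / d, 1 / d, 0],
      ![0, 0, 0, 0, 0, 1 / d]])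
  · exact IsListed.M2.classified (.of_basis ![![a13, 0, 0, 0, 0, 0], ![0, 1, 0, 0, 0, 0],
      ![0, -p23, 1, 0, 0, 0], ![0, 0, 0, 1, 0, 0], ![0, 0, 0, -p14, 1, 0],
      ![0, 0, 0, 0, 0, 1]])

theorem classified_M1 (a12 a13 a14 a15 a23 a24 a25 a34 a35 a45 : ℂ) : Classified
    (prd 1 2 3 + prd 3 4 5 + cen a12 a13 a14 a15 a23 a24 a25 a34 a35 a45) := by
  intro hM
  obtain ⟨ν, hν, h⟩ := hM.exists_copy
  simp [Fin.forall_fin_succ, prd_apply] at h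
  have h1 := congrFun (hν.2 ![0, 1, 0, 0, 0, 0] ![0, 0, 1, 0, 0, 0] ![0, 0, 0, 0, 1, 0]) 0
  have h2 := congrFun (hν.2 ![0, 0, 1, 0, 0, 0] ![0, 1, 0, 0, 0, 0] ![0, 0, 0, 0, 1, 0]) 0
  have h3 := congrFun (hν.2 ![0, 0, 0, 0, 1, 0] ![0, 1, 0, 0, 0, 0] ![0, 0, 1, 0, 0, 0]) 0
  -- The sum `e₁ + e₃` polarises the identity and reaches `a35`.
  have h4 := congrFun (hν.2 ![0, 1, 0, 1, 0, 0] ![0, 0, 0, 0, 1, 0] ![0, 0, 1, 0, 0, 0]) 0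
  simp [jac, h] at h1 h2 h3 h4
  clear h
  obtain rfl : a15 = 0 := by grind
  obtain rfl : a25 = 0 := by grind
  obtain rfl : a35 = 0 := by grind
  obtain rfl : a45 = 0 := by grind
  suffices key : Classified (prd 1 2 3 + prd 3 4 5 + cen 0 a13 a14 0 a23 a24 0 0 0 0) from
    key.of_iso (.of_basis ![![1, 0, 0, 0, 0, 0], ![0, 1, 0, 0, 0, 0], ![0, 0, 1, 0, 0, 0],
      ![a12, 0, 0, 1, 0, 0], ![0, 0, 0, 0, 1, 0], ![a34, 0, 0, 0, 0, 1]]) hM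
  clear h1 h2 h3 h4 hM
  rcases ne_or_eq a13 0 with h | rfl
  · exact classified_M1_of_a13 h
  rcases ne_or_eq a23 0 with h | rfl
  · exact (classified_M1_of_a13 (a14 := a24) (a23 := 0) (a24 := a14) (neg_ne_zero.2 h)).of_iso
      (.of_basis ![![1, 0, 0, 0, 0, 0], ![0, 0, 1, 0, 0, 0], ![0, 1, 0, 0, 0, 0],
        ![0, 0, 0, -1, 0, 0], ![0, 0, 0, 0, 1, 0], ![0, 0, 0, 0, 0, -1]])
  rcases ne_or_eq a14 0 with h | rfl
  · exact IsListed.M3.classified (.of_basis ![![a14, 0, 0, 0, 0, 0], ![0, 1, 0, 0, 0, 0],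
      ![0, -a24 / a14, 1, 0, 0, 0], ![0, 0, 0, 1, 0, 0], ![0, 0, 0, 0, 1, 0],
      ![0, 0, 0, 0, 0, 1]])
  rcases ne_or_eq a24 0 with h | rfl
  · exact IsListed.M3.classified (.of_basis ![![a24, 0, 0, 0, 0, 0], ![0, 0, 1, 0, 0, 0],
      ![0, 1, 0, 0, 0, 0], ![0, 0, 0, -1, 0, 0], ![0, 0, 0, 0, 1, 0],
      ![0, 0, 0, 0, 0, -1]])
  intro _ hZ
  have := hZ.coord_eq_zero ![1, 0, 0, 0, 0, 0] 0
  simp at this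

end M1

/-! ### Extensions of `L4`. -/

section L4

/-- By the Pfaffian condition `a23 e₁ - a13 e₂ + a12 e₃` and `a24 e₁ - a14 e₂ + a12 e₄` span the
radical of the second form. Apart from `e₁e₂`, products in the adapted basis lie in the line of
`e₅`, so this is an extension of `L2`. -/
theorem classified_L4_of_a12 {a12 a13 a14 a23 a24 a34 : ℂ} (h : a12 ≠ 0)
    (hp : a12 * a34 - a13 * a24 + a14 * a23 = 0) :
    Classified (prd 1 2 5 + prd 3 4 5 + cen a12 a13 a14 0 a23 a24 0 a34 0 0) :=
  (classified_L2 0 0 (-a13) (-a14) 0 (-a23) (-a24) 0 0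
    (a12 ^ 2 + a13 * a24 - a23 * a14)).of_iso (.of_basis ![![0, 0, 0, 0, 0, 1],
      ![0, 1, 0, 0, 0, 0], ![0, 0, 1, 0, 0, 0], ![a12, 0, 0, 0, 0, 1],
      ![0, a23, -a13, a12, 0, 0], ![0, a24, -a14, 0, a12, 0]])

theorem classified_L4_of_a13 {a13 a14 a23 a24 : ℂ} (h : a13 ≠ 0)
    (hp : a14 * a23 = a13 * a24) :
    Classified (prd 1 2 5 + prd 3 4 5 + cen 0 a13 a14 0 a23 a24 0 0 0 0) :=
  (classified_L2 0 0 a13 0 0 0 a13 0 0 0).of_iso (.of_basis ![![0, 0, 0, 0, 0, 1],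
      ![0, 1, 0, 0, 0, 0], ![0, 0, 0, 1, 0, 0], ![a13, 0, 0, 0, 0, 0],
      ![0, -a23, a13, 0, 0, 0], ![0, 0, 0, -a14, a13, 0]])

theorem classified_L4_of_pfaffian {a12 a13 a14 a23 a24 a34 : ℂ}
    (hp : a12 * a34 - a13 * a24 + a14 * a23 = 0) :
    Classified (prd 1 2 5 + prd 3 4 5 + cen a12 a13 a14 0 a23 a24 0 a34 0 0) := by
  rcases ne_or_eq a12 0 with h | rfl
  · exact classified_L4_of_a12 h hp
  rcases ne_or_eq a34 0 with h | rfl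
  · exact (classified_L4_of_a12 (a12 := a34) (a13 := -a13) (a14 := -a23) (a23 := -a14)
      (a24 := -a24) (a34 := 0) h (by linear_combination hp)).of_iso
      (.of_basis ![![1, 0, 0, 0, 0, 0], ![0, 0, 0, 1, 0, 0], ![0, 0, 0, 0, 1, 0],
        ![0, 1, 0, 0, 0, 0], ![0, 0, 1, 0, 0, 0], ![0, 0, 0, 0, 0, 1]])
  rcases ne_or_eq a13 0 with h | rfl
  · exact classified_L4_of_a13 h (by linear_combination hp)
  rcases ne_or_eq a14 0 with h | rfl
  · exact (classified_L4_of_a13 (a13 := a14) (a14 := 0) (a23 := a24)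
      (a24 := -a23) h (by linear_combination hp)).of_iso
      (.of_basis ![![1, 0, 0, 0, 0, 0], ![0, 1, 0, 0, 0, 0], ![0, 0, 1, 0, 0, 0],
        ![0, 0, 0, 0, 1, 0], ![0, 0, 0, -1, 0, 0], ![0, 0, 0, 0, 0, 1]])
  rcases ne_or_eq a23 0 with h | rfl
  · exact (classified_L4_of_a13 (a13 := a23) (a14 := a24) (a23 := 0)
      (a24 := 0) h (by ring)).of_iso
      (.of_basis ![![1, 0, 0, 0, 0, 0], ![0, 0, 1, 0, 0, 0], ![0, -1, 0, 0, 0, 0],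
        ![0, 0, 0, 1, 0, 0], ![0, 0, 0, 0, 1, 0], ![0, 0, 0, 0, 0, 1]])
  rcases ne_or_eq a24 0 with h | rfl
  · exact (classified_L4_of_a13 (a13 := a24) (a14 := 0) (a23 := 0)
      (a24 := 0) h (by ring)).of_iso
      (.of_basis ![![1, 0, 0, 0, 0, 0], ![0, 0, 1, 0, 0, 0], ![0, -1, 0, 0, 0, 0],
        ![0, 0, 0, 0, 1, 0], ![0, 0, 0, -1, 0, 0], ![0, 0, 0, 0, 0, 1]])
  intro _ hZ
  have := hZ.coord_eq_zero ![1, 0, 0, 0, 0, 0] 0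
  simp at this

theorem classified_L4_of_a15 {a13 a14 a15 a23 a24 a25 a34 a35 a45 : ℂ} (h : a15 ≠ 0) :
    Classified (prd 1 2 5 + prd 3 4 5 + cen 0 a13 a14 a15 a23 a24 a25 a34 a35 a45) := by
  suffices key : ∀ b c : ℂ,
      Classified (prd 1 2 5 + prd 3 4 5 + cen 0 0 0 1 b c 0 0 0 0) by
    obtain ⟨p13, rfl⟩ := mul_right_surjective₀ h a13
    obtain ⟨p14, rfl⟩ := mul_right_surjective₀ h a14
    obtain ⟨p23, rfl⟩ := mul_right_surjective₀ h a23
    obtain ⟨p24, rfl⟩ := mul_right_surjective₀ h a24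
    obtain ⟨p25, rfl⟩ := mul_right_surjective₀ h a25
    obtain ⟨p34, rfl⟩ := mul_right_surjective₀ h a34
    obtain ⟨p35, rfl⟩ := mul_right_surjective₀ h a35
    obtain ⟨p45, rfl⟩ := mul_right_surjective₀ h a45
    exact (key (p23 - p25 * p13 - p35 * p34 - p35 * (p45 * p13 - p35 * p14))
      (p24 - p25 * p14 - p45 * p34 - p45 * (p45 * p13 - p35 * p14))).of_iso
      (.of_basis ![![a15, 0, 0, 0, 0, 0], ![0, 1, 0, 0, 0, 0],
        ![0, -p25, 1, -p45, p35, p34 + 2 * p13 * p45 - 2 * p14 * p35],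
        ![0, -p35, 0, 1, 0, -p13], ![0, -p45, 0, 0, 1, -p14],
        ![a15 * (p34 + p13 * p45 - p14 * p35), 0, 0, 0, 0, 1]])
  intro b c
  -- Changes of `e₃, e₄` must have determinant one to keep `e₃e₄ = e₅`.
  rcases ne_or_eq b 0 with h | rfl
  · exact IsListed.M11.classified (.of_basis ![![1, 0, 0, 0, 0, 0], ![0, 1, 0, 0, 0, 0],
      ![0, 0, 1, 0, 0, 0], ![0, 0, 0, 1 / b, 0, 0], ![0, 0, 0, -c, b, 0], ![0, 0, 0, 0, 0, 1]])
  rcases ne_or_eq c 0 with h | rfl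
  · exact IsListed.M11.classified (.of_basis ![![1, 0, 0, 0, 0, 0], ![0, 1, 0, 0, 0, 0],
      ![0, 0, 1, 0, 0, 0], ![0, 0, 0, 0, 1 / c, 0], ![0, 0, 0, -c, 0, 0], ![0, 0, 0, 0, 0, 1]])
  exact IsListed.M10.classified (.of_basis ![![1, 0, 0, 0, 0, 0], ![0, 1, 0, 0, 0, 0],
      ![0, 0, 1, 0, 0, 0], ![0, 0, 0, 1, 0, 0], ![0, 0, 0, 0, 1, 0], ![0, 0, 0, 0, 0, 1]])

theorem classified_L4 (a12 a13 a14 a15 a23 a24 a25 a34 a35 a45 : ℂ) : Classified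
    (prd 1 2 5 + prd 3 4 5 + cen a12 a13 a14 a15 a23 a24 a25 a34 a35 a45) := by
  suffices key : ∀ a34, Classified
      (prd 1 2 5 + prd 3 4 5 + cen 0 a13 a14 a15 a23 a24 a25 a34 a35 a45) from
    (key (a34 - a12)).of_iso (.of_basis ![![1, 0, 0, 0, 0, 0], ![0, 1, 0, 0, 0, 0],
      ![0, 0, 1, 0, 0, 0], ![0, 0, 0, 1, 0, 0], ![0, 0, 0, 0, 1, 0], ![a12, 0, 0, 0, 0, 1]])
  clear a34 a12
  intro a34
  rcases ne_or_eq a15 0 with h | rfl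
  · exact classified_L4_of_a15 h
  rcases ne_or_eq a25 0 with h | rfl
  · exact (classified_L4_of_a15 (a13 := a23) (a14 := a24) (a23 := -a13) (a24 := -a14) (a25 := 0)
      (a34 := a34) (a35 := a35) (a45 := a45) h).of_iso
      (.of_basis ![![1, 0, 0, 0, 0, 0], ![0, 0, 1, 0, 0, 0], ![0, -1, 0, 0, 0, 0],
        ![0, 0, 0, 1, 0, 0], ![0, 0, 0, 0, 1, 0], ![0, 0, 0, 0, 0, 1]])
  rcases ne_or_eq a35 0 with h | rfl
  · exact (classified_L4_of_a15 (a13 := -a13) (a14 := -a23) (a23 := -a14) (a24 := -a24)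
      (a25 := a45) (a34 := -a34) (a35 := 0) (a45 := 0) h).of_iso
      (.of_basis ![![1, 0, 0, 0, 0, 0], ![0, 0, 0, 1, 0, 0], ![0, 0, 0, 0, 1, 0],
        ![0, 1, 0, 0, 0, 0], ![0, 0, 1, 0, 0, 0], ![a34, 0, 0, 0, 0, 1]])
  rcases ne_or_eq a45 0 with h | rfl
  · exact (classified_L4_of_a15 (a13 := -a14) (a14 := -a24) (a23 := a13) (a24 := a23)
      (a25 := 0) (a34 := -a34) (a35 := 0) (a45 := 0) h).of_iso
      (.of_basis ![![1, 0, 0, 0, 0, 0], ![0, 0, 0, 0, 1, 0], ![0, 0, 0, -1, 0, 0],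
        ![0, 1, 0, 0, 0, 0], ![0, 0, 1, 0, 0, 0], ![a34, 0, 0, 0, 0, 1]])
  -- Adding `s` times the first form to the second has a monic quadratic Pfaffian in `s`, so over
  -- `ℂ` some such form is degenerate.
  obtain ⟨s, hs⟩ : ∃ s, 1 * (s * s) + a34 * s + (a14 * a23 - a13 * a24) = 0 := by
    obtain ⟨r, hr⟩ := IsAlgClosed.exists_pow_nat_eq
      (discrim 1 a34 (a14 * a23 - a13 * a24)) (n := 2) (by norm_num)
    exact exists_quadratic_eq_zero one_ne_zero ⟨r, by rw [← hr, sq]⟩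
  exact (classified_L4_of_pfaffian (a12 := s) (a13 := a13) (a14 := a14) (a23 := a23) (a24 := a24)
    (a34 := s + a34) (by linear_combination hs)).of_iso
    (.of_basis ![![1, 0, 0, 0, 0, 0], ![0, 1, 0, 0, 0, 0], ![0, 0, 1, 0, 0, 0],
      ![0, 0, 0, 1, 0, 0], ![0, 0, 0, 0, 1, 0], ![-s, 0, 0, 0, 0, 1]])

end L4

/-! ### Extensions of `L9`. -/

section L9

/-- The coefficients form a symmetric matrix `(a, b; b, d)`, pairing `x, y` in the span of `e₁, e₂`
by `x(y e₃)`. Completing the square leaves only its rank. -/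
theorem classified_L9_of_a14 {a b d : ℂ} (h : a ≠ 0) : Classified
    (prd 1 2 3 + prd 1 3 4 + prd 2 3 5 + cen 0 0 a b 0 b d 0 0 0) := by
  obtain ⟨q, rfl⟩ := mul_right_surjective₀ h b
  obtain ⟨r, rfl⟩ : ∃ r, d = a * (r ^ 2 + q ^ 2) := by
    obtain ⟨r, hr⟩ := IsAlgClosed.exists_pow_nat_eq (d / a - q ^ 2) (n := 2) (by norm_num)
    exact ⟨r, by rw [hr]; field_simp; ring⟩
  rcases ne_or_eq r 0 with h' | rfl
  · exact IsListed.L21b.classified (.of_basis ![![a * r ^ 3, 0, 0, 0, 0, 0],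
      ![0, r, 0, 0, 0, 0], ![0, -q, 1, 0, 0, 0], ![0, 0, 0, r, 0, 0], ![0, 0, 0, 0, r ^ 2, 0],
      ![0, 0, 0, 0, -q * r, r]])
  · exact IsListed.L21a.classified (.of_basis ![![a, 0, 0, 0, 0, 0],
      ![0, 1, 0, 0, 0, 0], ![0, -q, 1, 0, 0, 0], ![0, 0, 0, 1, 0, 0], ![0, 0, 0, 0, 1, 0],
      ![0, 0, 0, 0, -q, 1]])

theorem classified_L9 (a12 a13 a14 a15 a23 a24 a25 a34 a35 a45 : ℂ) : Classified
    (prd 1 2 3 + prd 1 3 4 + prd 2 3 5 + cen a12 a13 a14 a15 a23 a24 a25 a34 a35 a45) := by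
  intro hM
  obtain ⟨ν, hν, h⟩ := hM.exists_copy
  simp [Fin.forall_fin_succ, prd_apply] at h
  have h1 := congrFun (hν.2 ![0, 1, 0, 0, 0, 0] ![0, 0, 1, 0, 0, 0] ![0, 0, 1, 0, 0, 0]) 0
  have h2 := congrFun (hν.2 ![0, 1, 0, 0, 0, 0] ![0, 0, 1, 0, 0, 0] ![0, 0, 0, 1, 0, 0]) 0
  have h3 := congrFun (hν.2 ![0, 1, 0, 0, 0, 0] ![0, 0, 0, 0, 0, 1] ![0, 0, 1, 0, 0, 0]) 0
  have h4 := congrFun (hν.2 ![0, 0, 1, 0, 0, 0] ![0, 1, 0, 0, 0, 0] ![0, 0, 0, 1, 0, 0]) 0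
  simp [jac, h] at h1 h2 h3 h4
  clear h
  obtain rfl : a24 = a15 := by grind
  obtain rfl : a34 = 0 := by grind
  obtain rfl : a35 = 0 := by grind
  obtain rfl : a45 = 0 := by grind
  suffices key : Classified
      (prd 1 2 3 + prd 1 3 4 + prd 2 3 5 + cen 0 0 a14 a24 0 a24 a25 0 0 0) from
    key.of_iso (.of_basis ![![1, 0, 0, 0, 0, 0], ![0, 1, 0, 0, 0, 0], ![0, 0, 1, 0, 0, 0],
      ![a12, 0, 0, 1, 0, 0], ![a13, 0, 0, 0, 1, 0], ![a23, 0, 0, 0, 0, 1]]) hM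
  clear h1 h2 h3 h4 hM
  rcases ne_or_eq a14 0 with h | rfl
  · exact classified_L9_of_a14 h
  rcases ne_or_eq a25 0 with h | rfl
  · exact (classified_L9_of_a14 (b := -a24) (d := 0) (neg_ne_zero.2 h)).of_iso
      (.of_basis ![![1, 0, 0, 0, 0, 0], ![0, 0, 1, 0, 0, 0], ![0, 1, 0, 0, 0, 0],
        ![0, 0, 0, -1, 0, 0], ![0, 0, 0, 0, 0, -1], ![0, 0, 0, 0, -1, 0]])
  rcases ne_or_eq a24 0 with h | rfl
  · exact (classified_L9_of_a14 (b := a24) (d := 0) (mul_ne_zero two_ne_zero h)).of_iso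
      (.of_basis ![![1, 0, 0, 0, 0, 0], ![0, 1, 1, 0, 0, 0], ![0, 0, 1, 0, 0, 0],
        ![0, 0, 0, 1, 0, 0], ![0, 0, 0, 0, 1, 1], ![0, 0, 0, 0, 0, 1]])
  intro _ hZ
  have := hZ.coord_eq_zero ![1, 0, 0, 0, 0, 0] 0
  simp at this

end L9

/-! ### Extensions of `L7`. -/

section L7

theorem classified_L7 (a12 a13 a14 a15 a23 a24 a25 a34 a35 a45 : ℂ) : Classified
    (prd 1 2 3 + prd 1 3 4 + prd 1 4 5 + cen a12 a13 a14 a15 a23 a24 a25 a34 a35 a45) := by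
  intro hM
  obtain ⟨ν, hν, h⟩ := hM.exists_copy
  simp [Fin.forall_fin_succ, prd_apply] at h
  have h1 := congrFun (hν.2 ![0, 1, 0, 0, 0, 0] ![0, 0, 1, 0, 0, 0] ![0, 0, 1, 0, 0, 0]) 0
  have h2 := congrFun (hν.2 ![0, 1, 0, 0, 0, 0] ![0, 0, 1, 0, 0, 0] ![0, 0, 0, 1, 0, 0]) 0
  have h3 := congrFun (hν.2 ![0, 1, 0, 0, 0, 0] ![0, 0, 1, 0, 0, 0] ![0, 0, 0, 0, 1, 0]) 0
  have h4 := congrFun (hν.2 ![0, 1, 0, 0, 0, 0] ![0, 0, 0, 1, 0, 0] ![0, 0, 0, 0, 1, 0]) 0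
  simp [jac, h] at h1 h2 h3 h4
  clear h
  obtain rfl : a24 = 0 := by grind
  obtain rfl : a34 = -a25 := by grind
  obtain rfl : a35 = 0 := by grind
  obtain rfl : a45 = 0 := by grind
  suffices key : Classified
      (prd 1 2 3 + prd 1 3 4 + prd 1 4 5 + cen 0 0 0 a15 a23 0 a25 (-a25) 0 0) from
    key.of_iso (.of_basis ![![1, 0, 0, 0, 0, 0], ![0, 1, 0, 0, 0, 0], ![0, 0, 1, 0, 0, 0],
      ![a12, 0, 0, 1, 0, 0], ![a13, 0, 0, 0, 1, 0], ![a14, 0, 0, 0, 0, 1]]) hM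
  clear h1 h2 h3 h4 hM
  rcases ne_or_eq a25 0 with h | rfl
  · obtain ⟨p15, rfl⟩ := mul_right_surjective₀ h a15
    -- In the product of `e₂ + c e₄` and `e₃ + c e₅` the term `c a25` occurs twice, because `a34 =
    -- -a25`; this cancels `a23`.
    obtain ⟨c, rfl⟩ : ∃ c, a23 = -2 * c * a25 := ⟨-a23 / (2 * a25), by field_simp⟩
    exact IsListed.L16.classified (.of_basis ![![a25, 0, 0, 0, 0, 0], ![0, 1, -p15, 0, 0, 0],
      ![0, 0, 1, 0, c, 0], ![0, 0, 0, 1, 0, c], ![2 * a25 * p15 * c, 0, 0, 0, 1, 0],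
      ![0, 0, 0, 0, 0, 1]])
  rcases ne_or_eq a15 0 with h | rfl
  · rcases ne_or_eq a23 0 with h' | rfl
    · exact IsListed.L17.classified (.of_basis ![![a15 * (a15 / a23), 0, 0, 0, 0, 0],
        ![0, 1, 0, 0, 0, 0], ![0, 0, a15 / a23, 0, 0, 0], ![0, 0, 0, a15 / a23, 0, 0],
        ![0, 0, 0, 0, a15 / a23, 0], ![0, 0, 0, 0, 0, a15 / a23]])
    · exact IsListed.L18.classified (.of_basis ![![a15, 0, 0, 0, 0, 0],
        ![0, 1, 0, 0, 0, 0], ![0, 0, 1, 0, 0, 0], ![0, 0, 0, 1, 0, 0],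
        ![0, 0, 0, 0, 1, 0], ![0, 0, 0, 0, 0, 1]])
  rcases ne_or_eq a23 0 with h | rfl
  · exact IsListed.L21a.classified (.of_basis ![![0, 0, 0, 0, 0, 1],
      ![0, 1, 0, 0, 0, 0], ![0, 0, 1, 0, 0, 0], ![0, 0, 0, 1, 0, 0],
      ![0, 0, 0, 0, 1, 0], ![a23, 0, 0, 0, 0, 0]])
  intro _ hZ
  have := hZ.coord_eq_zero ![1, 0, 0, 0, 0, 0] 0
  simp at this

end L7

/-! ### Extensions of `L6`. -/

section L6

theorem classified_L6 (a12 a13 a14 a15 a23 a24 a25 a34 a35 a45 : ℂ) : Classified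
    (prd 1 2 3 + prd 1 3 4 + prd 1 4 5 + prd 2 3 5 +
      cen a12 a13 a14 a15 a23 a24 a25 a34 a35 a45) := by
  intro hM
  obtain ⟨ν, hν, h⟩ := hM.exists_copy
  simp [Fin.forall_fin_succ, prd_apply] at h
  have h1 := congrFun (hν.2 ![0, 1, 0, 0, 0, 0] ![0, 0, 1, 0, 0, 0] ![0, 0, 1, 0, 0, 0]) 0
  have h2 := congrFun (hν.2 ![0, 1, 0, 0, 0, 0] ![0, 0, 1, 0, 0, 0] ![0, 0, 0, 1, 0, 0]) 0
  have h3 := congrFun (hν.2 ![0, 1, 0, 0, 0, 0] ![0, 0, 1, 0, 0, 0] ![0, 0, 0, 0, 1, 0]) 0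
  have h4 := congrFun (hν.2 ![0, 1, 0, 0, 0, 0] ![0, 0, 0, 1, 0, 0] ![0, 0, 0, 0, 1, 0]) 0
  simp [jac, h] at h1 h2 h3 h4
  clear h
  obtain rfl : a24 = a15 := by grind
  obtain rfl : a34 = -a25 := by grind
  obtain rfl : a35 = 0 := by grind
  obtain rfl : a45 = 0 := by grind
  suffices key : ∀ a23, Classified (prd 1 2 3 + prd 1 3 4 + prd 1 4 5 + prd 2 3 5 +
      cen 0 0 0 a24 a23 a24 a25 (-a25) 0 0) from
    (key (a23 - a14)).of_iso (.of_basis ![![1, 0, 0, 0, 0, 0], ![0, 1, 0, 0, 0, 0],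
      ![0, 0, 1, 0, 0, 0], ![a12, 0, 0, 1, 0, 0], ![a13, 0, 0, 0, 1, 0],
      ![a14, 0, 0, 0, 0, 1]]) hM
  clear h1 h2 h3 h4 hM a23
  intro a23
  rcases ne_or_eq a25 0 with h | rfl
  · obtain ⟨b, rfl⟩ := mul_right_surjective₀ h a24
    obtain ⟨c, rfl⟩ : ∃ c, a23 = -(2 * c + b ^ 2) * a25 :=
      ⟨-(a23 / a25 + b ^ 2) / 2, by field_simp; ring⟩
    exact IsListed.L14.classified (.of_basis ![![a25, 0, 0, 0, 0, 0], ![0, 1, -b, 0, 0, 0],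
      ![0, 0, 1, 0, c, 0], ![-a25 * b ^ 2 * c, 0, 0, 1, 0, c],
      ![a25 * b * (2 * c + b ^ 2), 0, 0, 0, 1, -b], ![-a25 * b ^ 2, 0, 0, 0, 0, 1]])
  rcases ne_or_eq a24 0 with h | rfl
  · obtain ⟨c, rfl⟩ : ∃ c, a23 = 2 * c * a24 := ⟨a23 / (2 * a24), by field_simp⟩
    exact IsListed.L15.classified (.of_basis ![![a24, 0, 0, 0, 0, 0], ![0, 1, c, 0, 0, 0],
      ![0, 0, 1, 0, 0, 0], ![0, 0, 0, 1, 0, 0], ![2 * c ^ 2 * a24, 0, 0, 0, 1, c],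
      ![2 * c * a24, 0, 0, 0, 0, 1]])
  rcases ne_or_eq a23 0 with h | rfl
  · exact IsListed.L21a.classified (.of_basis ![![0, 0, 0, 0, 0, 1],
      ![0, 1, 0, 0, 0, 0], ![0, 0, 1, 0, 0, 0], ![0, 0, 0, 1, 0, 0],
      ![0, 0, 0, 0, 1, 0], ![a23, 0, 0, 0, 0, 1]])
  intro _ hZ
  have := hZ.coord_eq_zero ![1, 0, 0, 0, 0, 0] 0
  simp at this

end L6

/-! ### Extensions of the zero algebra, and the complete list. -/

theorem exists_radical (a12 a13 a14 a15 a23 a24 a25 a34 a35 a45 : ℂ) :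
    ∃ v : Fin 5 → ℂ, v ≠ 0 ∧ !![0, a12, a13, a14, a15; -a12, 0, a23, a24, a25;
      -a13, -a23, 0, a34, a35; -a14, -a24, -a34, 0, a45; -a15, -a25, -a35, -a45, 0].mulVec v
        = 0 := by
  rw [Matrix.exists_mulVec_eq_zero_iff]
  set M := !![0, a12, a13, a14, a15; -a12, 0, a23, a24, a25;
      -a13, -a23, 0, a34, a35; -a14, -a24, -a34, 0, a45; -a15, -a25, -a35, -a45, 0] with hM
  have h : M.transpose = -M := by
    ext i j
    fin_cases i <;> fin_cases j <;> simp [hM]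
  have h' := congrArg Matrix.det h
  rw [Matrix.det_transpose, Matrix.det_neg, Fintype.card_fin] at h'
  linear_combination h' / 2

/-- Vacuous: a skew matrix of odd order is singular, so there is a central vector outside the line
of `e₆`, which contains the square. -/
theorem classified_abelian {a12 a13 a14 a15 a23 a24 a25 a34 a35 a45 : ℂ} :
    Classified (cen a12 a13 a14 a15 a23 a24 a25 a34 a35 a45) := by
  intro _ hZ
  obtain ⟨v, hv, h⟩ := exists_radical a12 a13 a14 a15 a23 a24 a25 a34 a35 a45
  simp [funext_iff, Fin.forall_fin_succ, dotProduct, Fin.sum_univ_succ] at h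
  obtain ⟨h1, h2, h3, h4, h5⟩ := h
  have hc : ∀ x j, cen a12 a13 a14 a15 a23 a24 a25 a34 a35 a45
      ![0, v 0, v 1, v 2, v 3, v 4] x j = 0 := by
    intro x
    simp
    linear_combination -x 1 * h1 - x 2 * h2 - x 3 * h3 - x 4 * h4 - x 5 * h5
  refine absurd (funext fun i => ?_) hv
  have e1 := hZ.coord_eq_zero _ 1 hc
  have e2 := hZ.coord_eq_zero _ 2 hc
  have e3 := hZ.coord_eq_zero _ 3 hc
  have e4 := hZ.coord_eq_zero _ 4 hc
  have e5 := hZ.coord_eq_zero _ 5 hc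
  simp at e1 e2 e3 e4 e5
  fin_cases i <;> assumption

/-- Every nilpotent Malcev algebra of dimension six is zero or isomorphic to a listed one. -/
theorem classify_six {V : Type*} [AddCommGroup V] [Module ℂ V] {μ : Alg V}
    (hV : Module.finrank ℂ V = 6) (hN : IsNilp μ) (hM : IsMalcev μ) :
    ∃ ν : Alg (Fin 6 → ℂ), (ν = 0 ∨ IsListed ν) ∧ Iso μ ν := by
  refine classify_extensions hV hN hM (fun W B hW => classify_five hW) ?_ ?_
  · intro B hB
    cases hB with
    | zero => exact .inl extend_zero
    | L2 => exact .inr (by simp only [extend_pr]; exact .L2)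
    | L3 => exact .inr (by simp only [extend_add, extend_pr]; exact .L3)
    | L4 => exact .inr (by simp only [extend_add, extend_pr]; exact .L4)
    | L5 => exact .inr (by simp only [extend_add, extend_pr]; exact .L5)
    | L6 => exact .inr (by simp only [extend_add, extend_pr]; exact .L6)
    | L7 => exact .inr (by simp only [extend_add, extend_pr]; exact .L7)
    | L8 => exact .inr (by simp only [extend_add, extend_pr]; exact .L8)
    | L9 => exact .inr (by simp only [extend_add, extend_pr]; exact .L9)
    | M1 => exact .inr (by simp only [extend_add, extend_pr]; exact .M1)
  · intro B hB θ hθ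
    obtain ⟨a12, a13, a14, a15, a23, a24, a25, a34, a35, a45, h⟩ := extend_eq_six (B := B) hθ
    rw [h]
    suffices key : Classified (extend B 0 + cen a12 a13 a14 a15 a23 a24 a25 a34 a35 a45) by
      intro h1 h2
      obtain ⟨ν, hν, e⟩ := key h1 h2
      exact ⟨ν, .inr hν, e⟩
    cases hB with
    | zero =>
      rw [extend_zero, zero_add]
      exact classified_abelian
    | L2 => simp only [extend_pr]; exact classified_L2 _ _ _ _ _ _ _ _ _ _
    | L3 => simp only [extend_add, extend_pr]; exact classified_L3 _ _ _ _ _ _ _ _ _ _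
    | L4 => simp only [extend_add, extend_pr]; exact classified_L4 _ _ _ _ _ _ _ _ _ _
    | L5 => simp only [extend_add, extend_pr]; exact classified_L5 _ _ _ _ _ _ _ _ _ _
    | L6 => simp only [extend_add, extend_pr]; exact classified_L6 _ _ _ _ _ _ _ _ _ _
    | L7 => simp only [extend_add, extend_pr]; exact classified_L7 _ _ _ _ _ _ _ _ _ _
    | L8 => simp only [extend_add, extend_pr]; exact classified_L8 _ _ _ _ _ _ _ _ _ _
    | L9 => simp only [extend_add, extend_pr]; exact classified_L9 _ _ _ _ _ _ _ _ _ _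
    | M1 => simp only [extend_add, extend_pr]; exact classified_M1 _ _ _ _ _ _ _ _ _ _

end DimensionSix
end NilpMalcev

namespace NilpMalcev

/-! ### Properties of the listed algebras. -/

section ListedAlgebras

/-- It suffices to check the Malcev identity for an algebra with the same coordinates. -/
theorem isMalcev_of_coords {ν : Alg (Fin 6 → ℂ)} (hA : IsAnticomm ν)
    (h : ∀ ξ : Alg (Fin 6 → ℂ), (∀ x y i, ξ x y i = ν x y i) →
      ∀ x y z i, jac ξ x y (ξ x z) i = ξ (jac ξ x y z) x i) : IsMalcev ν :=
  ⟨hA, fun x y z => funext (h ν (fun _ _ _ => rfl) x y z)⟩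

/-- It suffices to check the Tortkara identity for an algebra with the same coordinates. -/
theorem isTortkara_of_coords {ν : Alg (Fin 6 → ℂ)} (hA : IsAnticomm ν)
    (h : ∀ ξ : Alg (Fin 6 → ℂ), (∀ x y i, ξ x y i = ν x y i) →
      ∀ x y z i, ξ (ξ x y) (ξ z y) i = ξ (jac ξ x y z) y i) : IsTortkara ν :=
  ⟨hA, fun x y z => funext (h ν (fun _ _ _ => rfl) x y z)⟩

/-- It suffices to check the Jacobi identity for an algebra with the same coordinates. -/
theorem isLie_of_coords {ν : Alg (Fin 6 → ℂ)} (hA : IsAnticomm ν)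
    (h : ∀ ξ : Alg (Fin 6 → ℂ), (∀ x y i, ξ x y i = ν x y i) →
      ∀ x y z i, jac ξ x y z i = 0) : IsLie ν :=
  ⟨hA, fun x y z => funext (h ν (fun _ _ _ => rfl) x y z)⟩

theorem isAnticomm_prd (i j k : Fin 6) : IsAnticomm (prd i j k) := fun x y => by
  ext l
  simp only [prd_apply, Pi.neg_apply]
  split_ifs <;> ring

theorem IsAnticomm.add {μ ν : Alg (Fin 6 → ℂ)} (hμ : IsAnticomm μ) (hν : IsAnticomm ν) :
    IsAnticomm (μ + ν) := fun x y => by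
  simp only [LinearMap.add_apply, hμ x y, hν x y, neg_add]

theorem IsAnticomm.sub {μ ν : Alg (Fin 6 → ℂ)} (hμ : IsAnticomm μ) (hν : IsAnticomm ν) :
    IsAnticomm (μ - ν) := fun x y => by
  simp only [LinearMap.sub_apply, hμ x y, hν x y]
  abel

theorem IsAnticomm.smul {μ : Alg (Fin 6 → ℂ)} (hμ : IsAnticomm μ) (c : ℂ) :
    IsAnticomm (c • μ) := fun x y => by
  simp only [LinearMap.smul_apply, hμ x y, smul_neg]

theorem IsListed.isAnticomm {ν : Alg (Fin 6 → ℂ)} (h : IsListed ν) : IsAnticomm ν := by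
  cases h <;> repeat' first
    | exact isAnticomm_prd _ _ _ | apply IsAnticomm.add | apply IsAnticomm.sub
    | apply IsAnticomm.smul

/-- A multiplication table whose products lie further down the flag gives a nilpotent algebra. -/
theorem isNilp_of_flag {ν : Alg (Fin 6 → ℂ)} (hA : IsAnticomm ν)
    (h1 : ∀ x y, ν x y 1 = 0) (h2 : ∀ x y, ν x y 2 = 0)
    (h3 : ∀ x y, y 1 = 0 → y 2 = 0 → ν x y 3 = 0)
    (h4 : ∀ x y, y 1 = 0 → y 2 = 0 → y 3 = 0 → ν x y 4 = 0)
    (h5 : ∀ x y, y 1 = 0 → y 2 = 0 → y 3 = 0 → y 4 = 0 → ν x y 5 = 0)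
    (h6 : ∀ x y, y 1 = 0 → y 2 = 0 → y 3 = 0 → y 4 = 0 → y 5 = 0 → ν x y 0 = 0) :
    IsNilp ν := by
  -- The thresholds are `2^k + 1`: a product of that length has a factor of length at least `2^(k-1)
  -- + 1`, which already lies one step down the flag.
  have key : ∀ n a, IsProd ν n a → 1 ≤ n ∧ (2 ≤ n → a 1 = 0 ∧ a 2 = 0) ∧ (3 ≤ n → a 3 = 0) ∧
      (5 ≤ n → a 4 = 0) ∧ (9 ≤ n → a 5 = 0) ∧ (17 ≤ n → a 0 = 0) := by
    intro n a ha
    induction ha with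
    | single a => simp
    | @mul m n a b ha hb iha ihb =>
      have flip : ∀ i, ν b a i = 0 → ν a b i = 0 := fun i hi => by
        rw [hA a b, Pi.neg_apply, hi, neg_zero]
      obtain ⟨hm, ha2, ha3, ha5, ha9, ha17⟩ := iha
      obtain ⟨hn, hb2, hb3, hb5, hb9, hb17⟩ := ihb
      refine ⟨by omega, fun _ => ⟨h1 a b, h2 a b⟩, fun h => ?_, fun h => ?_, fun h => ?_,
        fun h => ?_⟩
      · rcases le_or_gt 2 n with h' | h'
        · exact h3 a b (hb2 h').1 (hb2 h').2
        · have h' : 2 ≤ m := by omega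
          exact flip _ (h3 b a (ha2 h').1 (ha2 h').2)
      · rcases le_or_gt 3 n with h' | h'
        · have := hb2 (by omega)
          exact h4 a b this.1 this.2 (hb3 h')
        · have h' : 3 ≤ m := by omega
          have := ha2 (by omega)
          exact flip _ (h4 b a this.1 this.2 (ha3 h'))
      · rcases le_or_gt 5 n with h' | h'
        · have := hb2 (by omega)
          exact h5 a b this.1 this.2 (hb3 (by omega)) (hb5 h')
        · have h' : 5 ≤ m := by omega
          have := ha2 (by omega)
          exact flip _ (h5 b a this.1 this.2 (ha3 (by omega)) (ha5 h'))
      · rcases le_or_gt 9 n with h' | h'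
        · have := hb2 (by omega)
          exact h6 a b this.1 this.2 (hb3 (by omega)) (hb5 (by omega)) (hb9 h')
        · have h' : 9 ≤ m := by omega
          have := ha2 (by omega)
          exact flip _ (h6 b a this.1 this.2 (ha3 (by omega)) (ha5 (by omega)) (ha9 h'))
  refine ⟨17, by norm_num, fun a ha => ?_⟩
  obtain ⟨-, ha2, ha3, ha5, ha9, ha17⟩ := key 17 a ha
  ext i
  fin_cases i
  · exact ha17 (by norm_num)
  · exact (ha2 (by norm_num)).1
  · exact (ha2 (by norm_num)).2
  · exact ha3 (by norm_num)
  · exact ha5 (by norm_num)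
  · exact ha9 (by norm_num)

theorem IsListed.isNilp {ν : Alg (Fin 6 → ℂ)} (h : IsListed ν) : IsNilp ν := by
  refine isNilp_of_flag h.isAnticomm ?_ ?_ ?_ ?_ ?_ ?_ <;> cases h <;> intro x y <;>
    simp +contextual [prd_apply]

theorem IsListed.ne_zero {ν : Alg (Fin 6 → ℂ)} (h : IsListed ν) : ν ≠ 0 := by
  intro h0
  have h' : ∀ i, ν ![0, 1, 0, 0, 0, 0] ![0, 0, 1, 0, 0, 0] i = 0 := by simp [h0]
  clear h0
  simp only [Fin.forall_fin_succ] at h'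
  cases h <;> simp [prd_apply] at h'

set_option maxHeartbeats 4000000 in
theorem IsListed.isMalcev {ν : Alg (Fin 6 → ℂ)} (h : IsListed ν) : IsMalcev ν := by
  refine isMalcev_of_coords h.isAnticomm fun ξ hξ x y z => ?_
  cases h
  all_goals
    simp [Fin.forall_fin_succ, prd_apply] at hξ
    simp [Fin.forall_fin_succ, jac, hξ]
  all_goals try grind

-- The second alternative is needed only for `L14` and `L16`: in a Lie algebra the Tortkara identity
-- says `(ab)(cb) = 0`, while there `(e₁e₂)(e₁e₃) = e₃e₄ = -e₆`.
set_option maxHeartbeats 4000000 in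
theorem IsListed.isTortkara_or {ν : Alg (Fin 6 → ℂ)} (h : IsListed ν) :
    IsTortkara ν ∨ (IsLie ν ∧ ¬ IsMetabelian ν) := by
  have hA := h.isAnticomm
  cases h
  case' L14 | L16 =>
    right
    refine ⟨isLie_of_coords hA fun ξ hξ x y z => ?_, fun h => ?_⟩
    rotate_left
    · have := congrFun (h ![0, 1, 0, 0, 0, 0] ![0, 0, 1, 0, 0, 0] ![0, 1, 0, 0, 0, 0]
        ![0, 0, 0, 1, 0, 0]) 0
      simp [prd_apply] at this
  all_goals try refine .inl (isTortkara_of_coords hA fun ξ hξ x y z => ?_)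
  all_goals
    clear hA
    simp [Fin.forall_fin_succ, prd_apply] at hξ
    simp [Fin.forall_fin_succ, jac, hξ]
  all_goals try grind

end ListedAlgebras
end NilpMalcev

/-! ### The main theorem. -/

theorem mainTheorem3 :
    (∀ ν : NilpMalcev.Alg (Fin 6 → ℂ), NilpMalcev.IsListed ν →
      NilpMalcev.IsNilp ν ∧ NilpMalcev.IsMalcev ν ∧ ν ≠ 0) ∧
    ∀ (V : Type*) [AddCommGroup V] [Module ℂ V] (μ : NilpMalcev.Alg V),
      Module.finrank ℂ V = 6 → NilpMalcev.IsNilp μ → NilpMalcev.IsMalcev μ →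
        (¬ NilpMalcev.IsLie μ → NilpMalcev.IsTortkara μ) ∧
        (NilpMalcev.IsMetabelian μ → NilpMalcev.IsTortkara μ) ∧
        (NilpMalcev.IsTortkara μ → μ ≠ 0 →
          ∃ ν : NilpMalcev.Alg (Fin 6 → ℂ), NilpMalcev.IsListed ν ∧ NilpMalcev.Iso μ ν) := by
  refine ⟨fun ν h => ⟨h.isNilp, h.isMalcev, h.ne_zero⟩, fun V _ _ μ hV hN hM => ?_⟩
  obtain ⟨ν, hν, e⟩ := NilpMalcev.classify_six hV hN hM
  obtain ⟨f, hf⟩ := e.exists_surjHom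
  obtain ⟨g, hg⟩ := e.symm.exists_surjHom
  -- Identities pass from the model `ν` to `μ` along `g`; metabelianity passes from `μ` to `ν` along
  -- `f`, where it is refuted.
  have key : NilpMalcev.IsTortkara μ ∨ (NilpMalcev.IsLie μ ∧ ¬ NilpMalcev.IsMetabelian μ) := by
    rcases hν with rfl | hν
    · exact .inl (hg.isTortkara ⟨fun _ _ => by simp, fun _ _ _ => by simp⟩)
    · exact hν.isTortkara_or.imp hg.isTortkara fun h =>
        ⟨hg.isLie h.1, fun h' => h.2 (hf.isMetabelian h')⟩
  refine ⟨fun h => key.resolve_right fun h' => h h'.1, fun h => key.resolve_right fun h' => h'.2 h,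
    fun _ h0 => ⟨ν, hν.resolve_left ?_, e⟩⟩
  rintro rfl
  obtain ⟨f, hf⟩ := e
  refine h0 (LinearMap.ext₂ fun x y => f.injective ?_)
  rw [hf]
  simp
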